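/- Let $U$ be a real separable Hilbert space and let $\Lambda:\mathcal D(\Lambda)\subset U\to U$ be self-adjoint with $\langle\Lambda u,u\rangle_U\ge m|u|_U^2$ for all $u\in\mathcal D(\Lambda)$ and some $m>0$, and such that $\Lambda^{-1}$ is a trace class operator on $U$. Let $V=\mathcal D(\Lambda^{1/2})$ and let $V'$ be its dual, i.e. the completion of $U$ with respect to the norm $|a|_{V'}=|\Lambda^{-1/2}a|_U$; put $H=U\times V'$ with the product inner product. Let $$e^{tA}\begin{pmatrix}y\\z\end{pmatrix}=\begin{pmatrix}\cos(\sqrt\Lambda\,t)\,y+\Lambda^{-1/2}\sin(\sqrt\Lambda\,t)\,z\\-\Lambda^{1/2}\sin(\sqrt\Lambda\,t)\,y+\cos(\sqrt\Lambda\,t)\,z\end{pmatrix}$$ be the wave group on $H$, let $G:V'\to H$, $Ga=(0,a)$, and for $t>0$ let $Q_t=\int_0^t e^{sA}GG^*e^{sA^*}\,ds$ on $H$ (integral in the strong sense); $Q_t^{-1/2}$ denotes the pseudo-inverse of $Q_t^{1/2}$. For $h\in H$ let $\mathcal E_C(t,h)$ be the infimum of $\big(\int_0^t|u(s)|_{V'}^2ds\big)^{1/2}$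 over all controls $u\in L^2(0,t;V')$ for which the mild solution of $w'=Aw+Gu$, $w(0)=h$, satisfies $w(t)=0$. Then: 1. For all $t>0$ and $h\in H$: $e^{tA}h$ lies in the range of $Q_t^{1/2}$, at least one such control exists, and $\mathcal E_C(t,h)=|Q_t^{-1/2}e^{tA}h|_H$. 2. For every $T>0$ there is a constant $c_T>0$ such that for all $t\in(0,T)$ and all $h\in H$ $$|Q_t^{-1/2}e^{tA}h|_H\le\frac{c_T}{t^{3/2}}\,|h|_H .$$ 3. There is a constant $c>0$ such that for all $t>0$ and all $a\in V'$ $$|Q_t^{-1/2}e^{tA}Ga|_H\le\frac{c}{t^{1/2}}\,|Ga|_H=\frac{c}{t^{1/2}}\,|a|_{V'};$$ in particular, for all $t>0$ and $a\in U$, $$|Q_t^{-1/2}e^{tA}Ga|_H\le\frac{c}{t^{1/2}}\,|Ga|_H=\frac{c}{t^{1/2}}\,|\Lambda^{-1/2}a|_U .$$ -/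

import Mathlib

open MeasureTheory UniformSpace
open scoped InnerProductSpace

noncomputable section

namespace WaveControl

/-! ### Bounded operators on a real Hilbert space -/

section General

variable {E F : Type*} [NormedAddCommGroup E] [InnerProductSpace ℝ E] [CompleteSpace E]
  [NormedAddCommGroup F] [InnerProductSpace ℝ F] [CompleteSpace F]

/-- Trace class (nuclear) operators on a Hilbert space: `T x = ∑ ⟪a n, x⟫ b n` with
`∑ ‖a n‖ ‖b n‖ < ∞`. -/
def IsTraceClass (T : E →L[ℝ] E) : Prop :=
  ∃ a b : ℕ → E, Summable (fun n => ‖a n‖ * ‖b n‖) ∧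
    ∀ x : E, HasSum (fun n => ⟪a n, x⟫_ℝ • b n) (T x)

open Classical in
/-- The square root `T^{1/2}` of a positive bounded operator `T`: its unique positive square root
(and `0` if `T` has none, which does not happen for positive `T`). -/
def posSqrt (T : E →L[ℝ] E) : E →L[ℝ] E :=
  if h : ∃ S : E →L[ℝ] E, S.IsPositive ∧ S ∘L S = T then h.choose else 0

open Classical in
/-- The pseudo-inverse `T⁻¹ x` of a bounded operator: for `x` in the range of `T`, the unique
preimage of `x` orthogonal to the kernel of `T`, i.e. the preimage of minimal norm
(and `0` for `x` outside the range of `T`). -/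
def pseudoInv (T : E →L[ℝ] F) (x : F) : E :=
  if h : ∃ y : E, y ∈ (LinearMap.ker T.toLinearMap)ᗮ ∧ T y = x then h.choose else 0

open Classical in
/-- The strong integral `∫_a^b Φ(s) ds` of an operator valued function: the bounded operator
`x ↦ ∫_a^b Φ(s) x ds` (and `0` if these integrals do not exist or do not define a bounded
operator). -/
def strongIntegral (Φ : ℝ → E →L[ℝ] E) (a b : ℝ) : E →L[ℝ] E :=
  if h : ∃ T : E →L[ℝ] E, ∀ x : E,
      IntervalIntegrable (fun s => Φ s x) volume a b ∧ T x = ∫ s in a..b, Φ s x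
  then h.choose else 0

end General

variable {U : Type*} [NormedAddCommGroup U] [InnerProductSpace ℝ U] [CompleteSpace U]

/-- The standing assumption on `Λ : 𝒟(Λ) ⊆ U → U`: it is self-adjoint (in particular densely
defined), positive, i.e. `⟪Λ u, u⟫ ≥ m ‖u‖²` on `𝒟(Λ)` for some `m > 0`, and its inverse `Λ⁻¹` is
a trace class operator on `U`. -/
structure WaveHypothesis (Λ : U →ₗ.[ℝ] U) : Prop where
  selfAdjoint : IsSelfAdjoint Λ
  positive : ∃ m : ℝ, 0 < m ∧ ∀ u : Λ.domain, m * ‖(u : U)‖ ^ 2 ≤ ⟪Λ u, (u : U)⟫_ℝ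
  inverse_traceClass : ∃ R : U →L[ℝ] U,
    (∀ u : Λ.domain, R (Λ u) = u) ∧ (∀ x : U, ∃ h : R x ∈ Λ.domain, Λ ⟨R x, h⟩ = x) ∧
    IsTraceClass R

open Classical in
/-- The functional calculus `f(Λ)` for `Λ` with an orthonormal basis of eigenvectors (which exists
under `WaveHypothesis`, as `Λ⁻¹` is compact) and `f` bounded on the eigenvalues: the unique bounded
operator with `f(Λ) u = f(μ) u` whenever `Λ u = μ u`; see `funCalc_apply` and `funCalc_unique`. -/
def funCalc (Λ : U →ₗ.[ℝ] U) (f : ℝ → ℝ) : U →L[ℝ] U :=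
  if h : ∃ T : U →L[ℝ] U, ∀ (μ : ℝ) (u : Λ.domain), Λ u = μ • (u : U) → T u = f μ • (u : U)
  then h.choose else 0

/-- Trace class operators are compact. -/
theorem IsTraceClass.isCompactOperator {T : U →L[ℝ] U} (hT : IsTraceClass T) :
    IsCompactOperator T := by
  obtain ⟨a, b, hs, hT⟩ := hT
  let F : ℕ → U →L[ℝ] U := fun n => (innerSL ℝ (a n)).smulRight (b n)
  have hF : Summable F := by
    refine Summable.of_norm_bounded hs fun n => ?_
    simp [F, ContinuousLinearMap.norm_smulRight_apply]
  have hsum : HasSum F T := by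
    have h1 : ∑' n, F n = T := by
      ext x
      have h2 := (ContinuousLinearMap.apply ℝ U x).hasSum hF.hasSum
      exact h2.unique (hT x)
    exact h1 ▸ hF.hasSum
  refine isCompactOperator_of_tendsto (l := Filter.atTop) hsum (.of_forall fun s => ?_)
  have : ∀ s : Finset ℕ, (∑ n ∈ s, F n) ∈ compactOperator (RingHom.id ℝ) U U := by
    intro s
    refine Submodule.sum_mem _ fun n _ => ?_
    change IsCompactOperator (F n)
    have h3 : IsCompactOperator (innerSL ℝ (a n)) :=
      isCompactOperator_of_locallyCompactSpace_dom (innerSL ℝ (a n))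
    exact h3.clm_comp ((ContinuousLinearMap.id ℝ ℝ).smulRight (b n))
  exact this s

/-- `Λ⁻¹` is symmetric and compact, and has the same eigenvectors as `Λ`. -/
theorem WaveHypothesis.exists_inverse {Λ : U →ₗ.[ℝ] U} (hΛ : WaveHypothesis Λ) :
    ∃ R : U →L[ℝ] U, (R : U →ₗ[ℝ] U).IsSymmetric ∧ IsCompactOperator R ∧
      (∀ (r : ℝ) (x : U), R x = r • x → x ≠ 0 →
        ∃ h : x ∈ Λ.domain, r ≠ 0 ∧ Λ ⟨x, h⟩ = r⁻¹ • x) ∧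
      (∀ (μ : ℝ) (u : Λ.domain), Λ u = μ • (u : U) → (u : U) ≠ 0 →
        0 < μ ∧ R u = μ⁻¹ • (u : U)) := by
  obtain ⟨R, h1, h2, h3⟩ := hΛ.inverse_traceClass
  obtain ⟨m, hm, hpos⟩ := hΛ.positive
  refine ⟨R, ?_, h3.isCompactOperator, ?_, ?_⟩
  · intro x y
    obtain ⟨hx, ex⟩ := h2 x
    obtain ⟨hy, ey⟩ := h2 y
    have hadj := LinearPMap.adjoint_isFormalAdjoint hΛ.selfAdjoint.dense_domain
    rw [LinearPMap.isSelfAdjoint_def.mp hΛ.selfAdjoint] at hadj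
    have := hadj ⟨R x, hx⟩ ⟨R y, hy⟩
    rw [ex, ey] at this
    exact this.symm
  · intro r x hx h0
    obtain ⟨hd, e⟩ := h2 x
    have hr : r ≠ 0 := by
      rintro rfl
      rw [zero_smul] at hx
      apply h0
      rw [← e]
      have : (⟨R x, hd⟩ : Λ.domain) = 0 := Subtype.ext hx
      rw [this]; exact Λ.toFun.map_zero
    have hxd : x ∈ Λ.domain := by
      have : x = r⁻¹ • R x := by rw [hx, smul_smul, inv_mul_cancel₀ hr, one_smul]
      rw [this]; exact Λ.domain.smul_mem _ hd
    refine ⟨hxd, hr, ?_⟩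
    have : (⟨x, hxd⟩ : Λ.domain) = r⁻¹ • ⟨R x, hd⟩ := by
      apply Subtype.ext
      change x = r⁻¹ • R x
      rw [hx, smul_smul, inv_mul_cancel₀ hr, one_smul]
    rw [this, LinearPMap.map_smul, e]
  · intro μ u hu h0
    have hp := hpos u
    rw [hu, inner_smul_left, real_inner_self_eq_norm_sq] at hp
    have hn : 0 < ‖(u : U)‖ ^ 2 := by positivity
    have hμ : 0 < μ := lt_of_lt_of_le hm (le_of_mul_le_mul_right hp hn)
    refine ⟨hμ, ?_⟩
    have := h1 u
    rw [hu, map_smul] at this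
    rw [eq_inv_smul_iff₀ hμ.ne', this]

/-- The eigenvectors of `Λ` span a dense subspace of `U`. -/
theorem WaveHypothesis.dense_eigenvectors {Λ : U →ₗ.[ℝ] U} (hΛ : WaveHypothesis Λ) :
    Dense (Submodule.span ℝ {x : U | ∃ (μ : ℝ) (u : Λ.domain), (u : U) = x ∧ Λ u = μ • (u : U)} :
      Set U) := by
  obtain ⟨R, hsym, hc, h1, -⟩ := hΛ.exists_inverse
  have ho := ContinuousLinearMap.orthogonalComplement_iSup_eigenspaces_eq_bot hc hsym
  have hle : (⨆ μ, Module.End.eigenspace (R : U →ₗ[ℝ] U) μ) ≤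
      Submodule.span ℝ {x : U | ∃ (μ : ℝ) (u : Λ.domain), (u : U) = x ∧ Λ u = μ • (u : U)} := by
    refine iSup_le fun r x hx => ?_
    by_cases h0 : x = 0
    · rw [h0]; exact Submodule.zero_mem _
    obtain ⟨h, -, e⟩ := h1 r x (Module.End.mem_eigenspace_iff.mp hx) h0
    exact Submodule.subset_span ⟨r⁻¹, ⟨x, h⟩, rfl, e⟩
  rw [Submodule.dense_iff_topologicalClosure_eq_top, Submodule.topologicalClosure_eq_top_iff]
  exact le_bot_iff.mp (ho ▸ Submodule.orthogonal_le hle)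

/-- A bounded operator is determined by its values on the eigenvectors of `Λ`. -/
theorem WaveHypothesis.ext_eigenvectors {Λ : U →ₗ.[ℝ] U} (hΛ : WaveHypothesis Λ)
    {S T : U →L[ℝ] U}
    (h : ∀ (μ : ℝ) (u : Λ.domain), Λ u = μ • (u : U) → S u = T u) : S = T := by
  refine ContinuousLinearMap.ext_on hΛ.dense_eigenvectors ?_
  rintro _ ⟨μ, u, rfl, hu⟩
  exact h μ u hu

/-- Multiplication by a bounded family of scalars on a Hilbert sum. -/
theorem exists_multiplier {ι : Type*} {W : ι → Submodule ℝ U} [∀ i, CompleteSpace (W i)]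
    (hW : OrthogonalFamily ℝ (fun i => W i) fun i => (W i).subtypeₗᵢ)
    (htot : (⨆ i, W i)ᗮ = ⊥) (g : ι → ℝ) (C : ℝ) (hg : ∀ i, |g i| ≤ C) :
    ∃ T : U →L[ℝ] U, ∀ i, ∀ x ∈ W i, T x = g i • x := by
  classical
  have hH : IsHilbertSum ℝ (fun i => W i) fun i => (W i).subtypeₗᵢ :=
    IsHilbertSum.mkInternal W hW
      (by rw [(Submodule.topologicalClosure_eq_top_iff).mpr htot])
  have hbd : ∀ (w : lp (fun i => W i) 2) (i : ι), ‖g i • w i‖ ≤ ‖((C : ℝ) • w) i‖ := by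
    intro w i
    rw [lp.coeFn_smul, Pi.smul_apply, norm_smul, norm_smul]
    gcongr
    exact (hg i).trans (le_abs_self C)
  have hmem : ∀ w : lp (fun i => W i) 2, Memℓp (fun i => g i • w i) 2 := fun w =>
    Memℓp.mono' (lp.memℓp (C • w)) (hbd w)
  let M : lp (fun i => W i) 2 →ₗ[ℝ] lp (fun i => W i) 2 :=
    { toFun := fun w => ⟨fun i => g i • w i, hmem w⟩
      map_add' := fun v w => Subtype.ext (funext fun i => smul_add (g i) (v i) (w i))
      map_smul' := fun c w => Subtype.ext (funext fun i => smul_comm (g i) c (w i)) }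
  let M' : lp (fun i => W i) 2 →L[ℝ] lp (fun i => W i) 2 := M.mkContinuous |C| (by
    intro w
    rw [← Real.norm_eq_abs, ← norm_smul]
    exact lp.norm_mono (by norm_num) (hbd w))
  let e := hH.linearIsometryEquiv
  refine ⟨(e.symm.toContinuousLinearEquiv.toContinuousLinearMap ∘L M' ∘L
    e.toContinuousLinearEquiv.toContinuousLinearMap), fun i x hx => ?_⟩
  have hx' : e x = lp.single 2 i ⟨x, hx⟩ := by
    rw [← LinearIsometryEquiv.eq_symm_apply]
    simp [e]
  have hM : M' (e x) = g i • e x := by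
    rw [hx']
    ext j
    by_cases hj : j = i
    · subst hj; simp [M', M]
    · simp [M', M, hj]
  change e.symm (M' (e x)) = _
  rw [hM, map_smul, e.symm_apply_apply]

/-- `f(Λ) u = f(μ) u` for eigenvectors `u` of `Λ`, when `f` is bounded on the eigenvalues. -/
theorem funCalc_apply {Λ : U →ₗ.[ℝ] U} (hΛ : WaveHypothesis Λ) {f : ℝ → ℝ} {C : ℝ}
    (hf : ∀ (μ : ℝ) (u : Λ.domain), Λ u = μ • (u : U) → (u : U) ≠ 0 → |f μ| ≤ C)
    (μ : ℝ) (u : Λ.domain) (hu : Λ u = μ • (u : U)) : funCalc Λ f u = f μ • (u : U) := by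
  have h : ∃ T : U →L[ℝ] U, ∀ (μ : ℝ) (u : Λ.domain), Λ u = μ • (u : U) →
      T u = f μ • (u : U) := by
    classical
    obtain ⟨R, hsym, hc, -, h2⟩ := hΛ.exists_inverse
    have : ∀ r : ℝ, CompleteSpace (Module.End.eigenspace (R : U →ₗ[ℝ] U) r) := fun r =>
      (R.isClosed_eigenspace r).completeSpace_coe
    obtain ⟨T, hT⟩ := exists_multiplier hsym.orthogonalFamily_eigenspaces
      (ContinuousLinearMap.orthogonalComplement_iSup_eigenspaces_eq_bot hc hsym)
      (fun r => if |f r⁻¹| ≤ |C| then f r⁻¹ else 0) |C|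
      (by intro r; split_ifs with h <;> simp [h])
    refine ⟨T, fun μ u hu => ?_⟩
    by_cases h0 : (u : U) = 0
    · simp [h0]
    obtain ⟨-, hR⟩ := h2 μ u hu h0
    rw [hT μ⁻¹ u (Module.End.mem_eigenspace_iff.mpr hR), inv_inv,
      if_pos ((hf μ u hu h0).trans (le_abs_self C))]
  rw [funCalc, dif_pos h]
  exact h.choose_spec μ u hu

/-- `f(Λ)` is the only bounded operator with this property. -/
theorem funCalc_unique {Λ : U →ₗ.[ℝ] U} (hΛ : WaveHypothesis Λ) {f : ℝ → ℝ} {T : U →L[ℝ] U}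
    (hT : ∀ (μ : ℝ) (u : Λ.domain), Λ u = μ • (u : U) → T u = f μ • (u : U)) :
    funCalc Λ f = T := by
  have h : ∃ T : U →L[ℝ] U, ∀ (μ : ℝ) (u : Λ.domain), Λ u = μ • (u : U) →
      T u = f μ • (u : U) := ⟨T, hT⟩
  refine hΛ.ext_eigenvectors fun μ u hu => ?_
  rw [funCalc, dif_pos h, h.choose_spec μ u hu, hT μ u hu]

/-- `Λ^{-1/2} : U → U`. -/
def invSqrt (Λ : U →ₗ.[ℝ] U) : U →L[ℝ] U := funCalc Λ (fun μ => 1 / √μ)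

/-! ### The space `V'` -/

/-- `U`, to be normed by `‖Λ^{-1/2} u‖`. -/
def WeakU (_Λ : U →ₗ.[ℝ] U) : Type _ := U

instance (Λ : U →ₗ.[ℝ] U) : AddCommGroup (WeakU Λ) := inferInstanceAs (AddCommGroup U)

instance (Λ : U →ₗ.[ℝ] U) : Module ℝ (WeakU Λ) := inferInstanceAs (Module ℝ U)

/-- `Λ^{-1/2}` as a linear map on `WeakU Λ`. -/
def weakInvSqrt (Λ : U →ₗ.[ℝ] U) : WeakU Λ →ₗ[ℝ] U := (invSqrt Λ).toLinearMap

instance (Λ : U →ₗ.[ℝ] U) : SeminormedAddCommGroup (WeakU Λ) :=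
  SeminormedAddCommGroup.induced (WeakU Λ) U (weakInvSqrt Λ)

instance (Λ : U →ₗ.[ℝ] U) : InnerProductSpace ℝ (WeakU Λ) :=
  InnerProductSpace.induced (weakInvSqrt Λ)

/-- `V' = 𝒟(Λ^{-1/2})`, the dual of `V = 𝒟(Λ^{1/2})`: the completion of `U` with respect to the
norm `‖Λ^{-1/2} u‖`. -/
abbrev DualV (Λ : U →ₗ.[ℝ] U) : Type _ := Completion (WeakU Λ)

/-- The inclusion `U ⊆ V'`. -/
def incl (Λ : U →ₗ.[ℝ] U) : U →ₗ[ℝ] DualV Λ :=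
  (Completion.toComplₗᵢ (𝕜 := ℝ) (E := WeakU Λ)).toLinearMap

/-- `Λ^{-1/2} : V' → U`, the isometric extension of `Λ^{-1/2} : U → U`. -/
def invSqrtV (Λ : U →ₗ.[ℝ] U) : DualV Λ →L[ℝ] U :=
  (weakInvSqrt Λ).extendOfNorm (incl Λ)

/-- `Λ^{1/2} : U → V'`, the inverse of the unitary operator `Λ^{-1/2} : V' → U`, i.e. its
adjoint. -/
def sqrtV (Λ : U →ₗ.[ℝ] U) : U →L[ℝ] DualV Λ := (invSqrtV Λ).adjoint

/-- The functional calculus on `V'` of the extension `Λ : V → V'`, which is the operator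
`Λ^{1/2} Λ Λ^{-1/2}` on `V'`, unitarily equivalent to `Λ`. -/
def funCalcV (Λ : U →ₗ.[ℝ] U) (f : ℝ → ℝ) : DualV Λ →L[ℝ] DualV Λ :=
  sqrtV Λ ∘L funCalc Λ f ∘L invSqrtV Λ

set_option linter.unusedSectionVars false in
theorem denseRange_incl (Λ : U →ₗ.[ℝ] U) : DenseRange (incl Λ) :=
  Completion.denseRange_coe (α := WeakU Λ)

set_option linter.unusedSectionVars false in
theorem norm_incl (Λ : U →ₗ.[ℝ] U) (a : U) : ‖incl Λ a‖ = ‖invSqrt Λ a‖ :=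
  Completion.norm_coe (E := WeakU Λ) a

/-- `Λ^{-1/2} : V' → U` extends `Λ^{-1/2} : U → U`. -/
theorem invSqrtV_incl (Λ : U →ₗ.[ℝ] U) (a : U) : invSqrtV Λ (incl Λ a) = invSqrt Λ a :=
  LinearMap.extendOfNorm_eq (denseRange_incl Λ)
    ⟨1, fun x => by rw [one_mul]; exact (norm_incl Λ x).ge⟩ a

/-- `Λ^{-1/2} : V' → U` is isometric. -/
theorem norm_invSqrtV (Λ : U →ₗ.[ℝ] U) (z : DualV Λ) : ‖invSqrtV Λ z‖ = ‖z‖ := by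
  refine (denseRange_incl Λ).induction_on z
    (isClosed_eq (invSqrtV Λ).continuous.norm continuous_norm) fun a => ?_
  rw [invSqrtV_incl, norm_incl]

theorem sqrtV_invSqrtV (Λ : U →ₗ.[ℝ] U) (z : DualV Λ) : sqrtV Λ (invSqrtV Λ z) = z :=
  congrArg (fun T : DualV Λ →L[ℝ] DualV Λ => T z)
    ((ContinuousLinearMap.norm_map_iff_adjoint_comp_self (invSqrtV Λ)).mp (norm_invSqrtV Λ))

theorem invSqrt_apply {Λ : U →ₗ.[ℝ] U} (hΛ : WaveHypothesis Λ)
    (μ : ℝ) (u : Λ.domain) (hu : Λ u = μ • (u : U)) : invSqrt Λ u = (1 / √μ) • (u : U) := by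
  obtain ⟨m, hm, hpos⟩ := hΛ.positive
  refine funCalc_apply hΛ (C := 1 / √m) (fun ν v hv h0 => ?_) μ u hu
  have hp := hpos v
  rw [hv, inner_smul_left, real_inner_self_eq_norm_sq] at hp
  have hn : 0 < ‖(v : U)‖ ^ 2 := by positivity
  have hν : m ≤ ν := le_of_mul_le_mul_right hp hn
  rw [abs_of_nonneg (by positivity)]
  gcongr

/-- `Λ^{-1/2} : V' → U` is onto, so that `Λ^{1/2} : U → V'` is its inverse. -/
theorem invSqrtV_sqrtV {Λ : U →ₗ.[ℝ] U} (hΛ : WaveHypothesis Λ) (x : U) :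
    invSqrtV Λ (sqrtV Λ x) = x := by
  suffices h : invSqrtV Λ ∘L sqrtV Λ = ContinuousLinearMap.id ℝ U from
    congrArg (fun T : U →L[ℝ] U => T x) h
  refine hΛ.ext_eigenvectors fun μ u hu => ?_
  by_cases h0 : (u : U) = 0
  · simp [h0]
  obtain ⟨R, -, -, -, h2⟩ := hΛ.exists_inverse
  have hμ : 0 < √μ := Real.sqrt_pos.mpr (h2 μ u hu h0).1
  have hu' : (u : U) = invSqrtV Λ (√μ • incl Λ u) := by
    rw [map_smul, invSqrtV_incl, invSqrt_apply hΛ μ u hu, smul_smul, mul_one_div_cancel hμ.ne',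
      one_smul]
  rw [hu', ContinuousLinearMap.comp_apply, sqrtV_invSqrtV, ContinuousLinearMap.id_apply]

/-- For bounded `f`, the operator `f(Λ)` on `V'` extends `f(Λ)` on `U`. -/
theorem funCalcV_incl {Λ : U →ₗ.[ℝ] U} (hΛ : WaveHypothesis Λ) {f : ℝ → ℝ} {C : ℝ}
    (hf : ∀ μ, |f μ| ≤ C) (a : U) : funCalcV Λ f (incl Λ a) = incl Λ (funCalc Λ f a) := by
  have hc : funCalc Λ f ∘L invSqrt Λ = invSqrt Λ ∘L funCalc Λ f := by
    refine hΛ.ext_eigenvectors fun μ u hu => ?_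
    have h1 := funCalc_apply hΛ (fun ν _ _ _ => hf ν) μ u hu
    have h2 := invSqrt_apply hΛ μ u hu
    simp only [ContinuousLinearMap.comp_apply, h1, h2, map_smul]
    rw [smul_comm]
  have h3 : funCalc Λ f (invSqrt Λ a) = invSqrt Λ (funCalc Λ f a) :=
    congrArg (fun T : U →L[ℝ] U => T a) hc
  rw [funCalcV, ContinuousLinearMap.comp_apply, ContinuousLinearMap.comp_apply, invSqrtV_incl, h3,
    ← invSqrtV_incl, sqrtV_invSqrtV]

/-! ### The controlled wave equation in `H = U × V'` -/

/-- The Hilbert space `H = U × V'` with the product inner product. -/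
abbrev StateSpace (Λ : U →ₗ.[ℝ] U) : Type _ := WithLp 2 (U × DualV Λ)

/-- The control operator `G : V' → H`, `G a = (0, a)`. -/
def G (Λ : U →ₗ.[ℝ] U) : DualV Λ →L[ℝ] StateSpace Λ :=
  (WithLp.prodContinuousLinearEquiv 2 ℝ U (DualV Λ)).symm.toContinuousLinearMap ∘L
    ContinuousLinearMap.inr ℝ U (DualV Λ)

/-- The wave group
`e^{tA} (y, z) = (cos(√Λ t) y + Λ^{-1/2} sin(√Λ t) z, -Λ^{1/2} sin(√Λ t) y + cos(√Λ t) z)`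
on `H`, generated by `A (y, z) = (z, -Λ y)` with domain `V × U`. -/
def waveGroup (Λ : U →ₗ.[ℝ] U) (t : ℝ) : StateSpace Λ →L[ℝ] StateSpace Λ :=
  (WithLp.prodContinuousLinearEquiv 2 ℝ U (DualV Λ)).symm.toContinuousLinearMap ∘L
    (((funCalc Λ (fun μ => Real.cos (√μ * t))).coprod
        (invSqrtV Λ ∘L funCalcV Λ (fun μ => Real.sin (√μ * t)))).prod
      ((-(sqrtV Λ ∘L funCalc Λ (fun μ => Real.sin (√μ * t)))).coprod
        (funCalcV Λ (fun μ => Real.cos (√μ * t))))) ∘L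
    (WithLp.prodContinuousLinearEquiv 2 ℝ U (DualV Λ)).toContinuousLinearMap

/-- `Q_t = ∫_0^t e^{sA} G G^* e^{sA^*} ds`, where `e^{sA^*} = (e^{sA})^*`. -/
def Q (Λ : U →ₗ.[ℝ] U) (t : ℝ) : StateSpace Λ →L[ℝ] StateSpace Λ :=
  strongIntegral
    (fun s => waveGroup Λ s ∘L G Λ ∘L (G Λ).adjoint ∘L (waveGroup Λ s).adjoint) 0 t

/-- `Q_t^{-1/2}`, the pseudo-inverse of `Q_t^{1/2}`. -/
def QInvSqrt (Λ : U →ₗ.[ℝ] U) (t : ℝ) (x : StateSpace Λ) : StateSpace Λ :=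
  pseudoInv (posSqrt (Q Λ t)) x

/-- The mild solution of `w' = A w + G u`, `w(0) = h`. -/
def mildSolution (Λ : U →ₗ.[ℝ] U) (h : StateSpace Λ) (u : ℝ → DualV Λ) (t : ℝ) : StateSpace Λ :=
  waveGroup Λ t h + ∫ s in (0 : ℝ)..t, waveGroup Λ (t - s) (G Λ (u s))

/-- The control `u ∈ L²(0,t;V')` drives the solution from `h` to `0` in time `t`. -/
def Steers (Λ : U →ₗ.[ℝ] U) (t : ℝ) (h : StateSpace Λ) (u : ℝ → DualV Λ) : Prop :=
  MemLp u 2 (volume.restrict (Set.Ioc 0 t)) ∧ mildSolution Λ h u t = 0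

/-- The energies `(∫_0^t |u(s)|² ds)^{1/2}` of the controls driving `h` to `0` in time `t`. -/
def controlEnergies (Λ : U →ₗ.[ℝ] U) (t : ℝ) (h : StateSpace Λ) : Set ℝ :=
  {e | ∃ u : ℝ → DualV Λ, Steers Λ t h u ∧ e = √(∫ s in (0 : ℝ)..t, ‖u s‖ ^ 2)}

/-- The minimal energy `ℰ_C(t,h)`. -/
def minimalEnergy (Λ : U →ₗ.[ℝ] U) (t : ℝ) (h : StateSpace Λ) : ℝ :=
  sInf (controlEnergies Λ t h)

end WaveControl

end

open WaveControl

/-! Identifying `V'` with `U` through the unitary map `Λ^{-1/2}` turns `H` into `U × U`. There every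
operator in question is a `2 × 2` matrix of functions of `Λ` (`blockOp`): the wave group is the
rotation by the angle `√Λ t`, and `G G^*` is the projection onto the second coordinate. Since
eigenvectors of `Λ` are total, identities between such operators reduce to identities between scalar
matrices, one for each frequency `ω = √μ` with `μ` an eigenvalue.

Integrating the rotated projection shows that `Q_t` has the symbol with entries `∫ sin²`, `∫ sin
cos`, `∫ cos²` over `[0, t]`, of determinant `D = (t² - sin²(ωt)/ω²)/4 > 0`. Because `ω²` is bounded
below, `1/D` is at most a constant times `t⁻⁴` for `t ≤ T` (`pow_four_le_gramDet`), so `Q_t` is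
invertible, and its inverse is the adjugate matrix over `D`. Consequently the pseudo-inverse is a
true inverse and `|Q_t^{-1/2} x|² = ⟪x, Q_t⁻¹ x⟫` (`range_sqrt_Q_and_norm_sq`).

The three claims are then statements about this quadratic form at `x = e^{tA} h`. The control `-G^*
e^{(t-s)A^*} Q_t⁻¹ x` steers `h` to `0` with energy squared equal to the form, and completing the
square shows that no control does better (`isLeast_controlEnergies`). The entries of the adjugate
are at most `t` in absolute value, which gives `‖Q_t⁻¹‖ ≤ const · t⁻³`, hence the rate `t^{-3/2}`.
For `h = G a` only the lower right entry of the rotated inverse matters. It equals `∫ sin² / D`,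
which is at most `16 / t` whatever `ω` and `t` are (`intSinSq_div_gramDet_le`), hence the rate
`t^{-1/2}` with a constant independent of any time horizon. -/

noncomputable section

namespace WaveControl

/-! ### Functional calculus of `Λ` through its eigenvectors. -/

section FunctionalCalculus

variable {U : Type*} [NormedAddCommGroup U] [InnerProductSpace ℝ U]

/-- The eigenvalues of `Λ`. -/
def eigenvalueSet (Λ : U →ₗ.[ℝ] U) : Set ℝ :=
  {μ | ∃ u : Λ.domain, Λ u = μ • (u : U) ∧ (u : U) ≠ 0}

/-- `f` is bounded on the eigenvalues of `Λ`. -/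
def BddOnEigs (Λ : U →ₗ.[ℝ] U) (f : ℝ → ℝ) : Prop :=
  ∃ C, ∀ μ ∈ eigenvalueSet Λ, |f μ| ≤ C

variable {Λ : U →ₗ.[ℝ] U} {f g : ℝ → ℝ}

theorem BddOnEigs.of_le {C : ℝ} (h : ∀ μ, |f μ| ≤ C) : BddOnEigs Λ f := ⟨C, fun μ _ => h μ⟩

theorem BddOnEigs.const (c : ℝ) : BddOnEigs Λ (fun _ => c) := .of_le fun _ => le_rfl

theorem BddOnEigs.add (hf : BddOnEigs Λ f) (hg : BddOnEigs Λ g) :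
    BddOnEigs Λ (fun μ => f μ + g μ) := by
  obtain ⟨C, hC⟩ := hf
  obtain ⟨D, hD⟩ := hg
  exact ⟨C + D, fun μ h => (abs_add_le _ _).trans (add_le_add (hC μ h) (hD μ h))⟩

theorem BddOnEigs.mul (hf : BddOnEigs Λ f) (hg : BddOnEigs Λ g) :
    BddOnEigs Λ (fun μ => f μ * g μ) := by
  obtain ⟨C, hC⟩ := hf
  obtain ⟨D, hD⟩ := hg
  refine ⟨C * D, fun μ h => ?_⟩
  rw [abs_mul]
  exact mul_le_mul (hC μ h) (hD μ h) (abs_nonneg _) ((abs_nonneg _).trans (hC μ h))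

theorem BddOnEigs.neg (hf : BddOnEigs Λ f) : BddOnEigs Λ (fun μ => -f μ) := by
  obtain ⟨C, hC⟩ := hf
  exact ⟨C, fun μ h => by rw [abs_neg]; exact hC μ h⟩

variable [CompleteSpace U]

theorem WaveHypothesis.exists_lower_bound (hΛ : WaveHypothesis Λ) :
    ∃ m : ℝ, 0 < m ∧ ∀ μ ∈ eigenvalueSet Λ, m ≤ μ := by
  obtain ⟨m, hm, hpos⟩ := hΛ.positive
  refine ⟨m, hm, ?_⟩
  rintro μ ⟨u, hu, h0⟩
  have hp := hpos u
  rw [hu, inner_smul_left, real_inner_self_eq_norm_sq] at hp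
  have hn : 0 < ‖(u : U)‖ ^ 2 := by positivity
  exact le_of_mul_le_mul_right hp hn

theorem WaveHypothesis.eigenvalue_pos (hΛ : WaveHypothesis Λ) {μ : ℝ}
    (hμ : μ ∈ eigenvalueSet Λ) : 0 < μ := by
  obtain ⟨m, hm, h⟩ := hΛ.exists_lower_bound
  exact hm.trans_le (h μ hμ)

theorem funCalc_eigenvector (hΛ : WaveHypothesis Λ) (hf : BddOnEigs Λ f)
    {μ : ℝ} {u : Λ.domain} (hu : Λ u = μ • (u : U)) : funCalc Λ f u = f μ • (u : U) := by
  obtain ⟨C, hC⟩ := hf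
  exact funCalc_apply hΛ (fun ν v hv h0 => hC ν ⟨v, hv, h0⟩) μ u hu

/-- Only the values on eigenvalues matter. This is what allows later symbols to divide by `√μ`: the
scalar identities are needed for positive `μ` alone. -/
theorem funCalc_congr (hΛ : WaveHypothesis Λ) (hf : BddOnEigs Λ f)
    (h : ∀ μ ∈ eigenvalueSet Λ, f μ = g μ) : funCalc Λ f = funCalc Λ g := by
  refine (funCalc_unique hΛ fun μ u hu => ?_).symm
  rw [funCalc_eigenvector hΛ hf hu]
  by_cases h0 : (u : U) = 0
  · simp [h0]
  · rw [h μ ⟨u, hu, h0⟩]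

theorem funCalc_mul (hΛ : WaveHypothesis Λ) (hf : BddOnEigs Λ f) (hg : BddOnEigs Λ g) (x : U) :
    funCalc Λ (fun μ => f μ * g μ) x = funCalc Λ f (funCalc Λ g x) := by
  rw [← ContinuousLinearMap.comp_apply]
  congr 1
  refine funCalc_unique hΛ fun μ u hu => ?_
  rw [ContinuousLinearMap.comp_apply, funCalc_eigenvector hΛ hg hu, map_smul,
    funCalc_eigenvector hΛ hf hu, smul_smul, mul_comm]

theorem funCalc_add (hΛ : WaveHypothesis Λ) (hf : BddOnEigs Λ f) (hg : BddOnEigs Λ g) (x : U) :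
    funCalc Λ (fun μ => f μ + g μ) x = funCalc Λ f x + funCalc Λ g x := by
  rw [← _root_.add_apply]
  congr 1
  refine funCalc_unique hΛ fun μ u hu => ?_
  rw [_root_.add_apply, funCalc_eigenvector hΛ hg hu,
    funCalc_eigenvector hΛ hf hu, add_smul]

theorem funCalc_neg (hΛ : WaveHypothesis Λ) (hf : BddOnEigs Λ f) (x : U) :
    funCalc Λ (fun μ => -f μ) x = -funCalc Λ f x := by
  rw [← _root_.neg_apply]
  congr 1
  refine funCalc_unique hΛ fun μ u hu => ?_
  rw [_root_.neg_apply, funCalc_eigenvector hΛ hf hu, neg_smul]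

theorem funCalc_const (hΛ : WaveHypothesis Λ) (c : ℝ) (x : U) :
    funCalc Λ (fun _ => c) x = c • x := by
  have : funCalc Λ (fun _ => c) = c • ContinuousLinearMap.id ℝ U :=
    funCalc_unique hΛ fun μ u hu => rfl
  rw [this]; rfl

theorem WaveHypothesis.inner_symm (hΛ : WaveHypothesis Λ) (u v : Λ.domain) :
    ⟪Λ u, (v : U)⟫_ℝ = ⟪(u : U), Λ v⟫_ℝ := by
  have hadj := LinearPMap.adjoint_isFormalAdjoint hΛ.selfAdjoint.dense_domain
  rw [LinearPMap.isSelfAdjoint_def.mp hΛ.selfAdjoint] at hadj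
  exact hadj u v

/-- Two bounded operators are adjoint to each other if they are so on eigenvectors. -/
theorem WaveHypothesis.inner_ext (hΛ : WaveHypothesis Λ) {S T : U →L[ℝ] U}
    (h : ∀ (μ ν : ℝ) (u v : Λ.domain), Λ u = μ • (u : U) → Λ v = ν • (v : U) →
      ⟪S u, (v : U)⟫_ℝ = ⟪(u : U), T v⟫_ℝ) (x y : U) : ⟪S x, y⟫_ℝ = ⟪x, T y⟫_ℝ := by
  have key : T.adjoint = S := by
    refine hΛ.ext_eigenvectors fun μ u hu => ?_
    have : innerSL ℝ (T.adjoint u) = innerSL ℝ (S u) := by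
      refine ContinuousLinearMap.ext_on hΛ.dense_eigenvectors ?_
      rintro _ ⟨ν, v, rfl, hv⟩
      rw [innerSL_apply_apply, innerSL_apply_apply, ContinuousLinearMap.adjoint_inner_left,
        h μ ν u v hu hv]
    refine ext_inner_right ℝ fun w => ?_
    exact congrArg (fun F : U →L[ℝ] ℝ => F w) this
  rw [← key, ContinuousLinearMap.adjoint_inner_left]

/-- It suffices to test on eigenvectors: for equal eigenvalues the two sides agree, and for distinct
ones both vanish because the eigenvectors are orthogonal. -/
theorem funCalc_inner (hΛ : WaveHypothesis Λ) (hf : BddOnEigs Λ f) (x y : U) :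
    ⟪funCalc Λ f x, y⟫_ℝ = ⟪x, funCalc Λ f y⟫_ℝ := by
  refine hΛ.inner_ext (fun μ ν u v hu hv => ?_) x y
  rw [funCalc_eigenvector hΛ hf hu, funCalc_eigenvector hΛ hf hv, real_inner_smul_left,
    real_inner_smul_right]
  have h := hΛ.inner_symm u v
  rw [hu, hv, real_inner_smul_left, real_inner_smul_right] at h
  rcases eq_or_ne μ ν with rfl | hne
  · rfl
  · have : (μ - ν) * ⟪(u : U), (v : U)⟫_ℝ = 0 := by linarith
    rw [(mul_eq_zero.mp this).resolve_left (sub_ne_zero.mpr hne)]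
    simp

/-- With `g = √(C² - f²)` the calculus gives `f(Λ)² + g(Λ)² = C²`. Pairing with `x` yields `‖f(Λ)
x‖² + ‖g(Λ) x‖² = C² ‖x‖²`, so no expansion in an eigenbasis is needed. -/
theorem norm_funCalc_apply_le (hΛ : WaveHypothesis Λ) {C : ℝ} (hC : 0 ≤ C)
    (hf : ∀ μ ∈ eigenvalueSet Λ, |f μ| ≤ C) (x : U) : ‖funCalc Λ f x‖ ≤ C * ‖x‖ := by
  have hb : BddOnEigs Λ f := ⟨C, hf⟩
  have hsq : ∀ μ ∈ eigenvalueSet Λ, f μ ^ 2 ≤ C ^ 2 := fun μ h => sq_le_sq'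
    (abs_le.mp (hf μ h)).1 (abs_le.mp (hf μ h)).2
  let g : ℝ → ℝ := fun μ => √(C ^ 2 - f μ ^ 2)
  have hg : BddOnEigs Λ g := ⟨C, fun μ h => by
    rw [abs_of_nonneg (Real.sqrt_nonneg _)]
    exact Real.sqrt_le_iff.mpr ⟨hC, by nlinarith [sq_nonneg (f μ)]⟩⟩
  have h1 : funCalc Λ f (funCalc Λ f x) + funCalc Λ g (funCalc Λ g x) = C ^ 2 • x := by
    rw [← funCalc_mul hΛ hb hb, ← funCalc_mul hΛ hg hg, ← funCalc_add hΛ (hb.mul hb) (hg.mul hg),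
      ← funCalc_const hΛ]
    congr 1
    refine funCalc_congr hΛ ((hb.mul hb).add (hg.mul hg)) fun μ h => ?_
    have : g μ * g μ = C ^ 2 - f μ ^ 2 := Real.mul_self_sqrt (by linarith [hsq μ h])
    rw [this]; ring
  have h2 : ‖funCalc Λ f x‖ ^ 2 + ‖funCalc Λ g x‖ ^ 2 = C ^ 2 * ‖x‖ ^ 2 := by
    have := congrArg (fun y => ⟪x, y⟫_ℝ) h1
    simp only [inner_add_right, real_inner_smul_right] at this
    rwa [← funCalc_inner hΛ hb, ← funCalc_inner hΛ hg, real_inner_self_eq_norm_sq,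
      real_inner_self_eq_norm_sq, real_inner_self_eq_norm_sq] at this
  refine abs_le_of_sq_le_sq' ?_ (by positivity) |>.2
  nlinarith [sq_nonneg ‖funCalc Λ g x‖]

/-- Strong continuity extends from eigenvectors to all vectors under a uniform bound. -/
theorem continuous_funCalc (hΛ : WaveHypothesis Λ) {f : ℝ → ℝ → ℝ} {C : ℝ} (hC : 0 ≤ C)
    (hf : ∀ s μ, |f s μ| ≤ C) (hc : ∀ μ, Continuous fun s => f s μ) (x : U) :
    Continuous fun s => funCalc Λ (f s) x := by
  have hb : ∀ s, BddOnEigs Λ (f s) := fun s => .of_le (hf s)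
  have hspan : ∀ y ∈ Submodule.span ℝ
      {x : U | ∃ (μ : ℝ) (u : Λ.domain), (u : U) = x ∧ Λ u = μ • (u : U)},
      Continuous fun s => funCalc Λ (f s) y := by
    intro y hy
    induction hy using Submodule.span_induction with
    | mem y hy =>
      obtain ⟨μ, u, rfl, hu⟩ := hy
      simp only [fun s => funCalc_eigenvector hΛ (hb s) hu]
      exact (hc μ).smul continuous_const
    | zero => simpa using continuous_const
    | add y z _ _ hy hz => simp only [map_add]; exact hy.add hz
    | smul c y _ hy => simp only [map_smul]; exact hy.const_smul c
  refine continuous_of_uniform_approx_of_continuous fun u hu => ?_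
  obtain ⟨ε, hε, hεu⟩ := Metric.mem_uniformity_dist.mp hu
  -- The radius uses `C + 1` because `C` may be zero.
  obtain ⟨y, hy, hxy⟩ := Metric.dense_iff.mp hΛ.dense_eigenvectors x (ε / (C + 1)) (by positivity)
  refine ⟨_, hspan y hxy, fun s => hεu ?_⟩
  rw [dist_eq_norm, ← map_sub]
  refine (norm_funCalc_apply_le hΛ hC (fun μ _ => hf s μ) _).trans_lt ?_
  rw [Metric.mem_ball, dist_comm, dist_eq_norm, lt_div_iff₀ (by positivity)] at hy
  nlinarith [norm_nonneg (x - y)]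

/-- The left side depends on `x` through a bounded operator that acts on eigenvectors by the
integrated scalar, and `funCalc_unique` identifies it. -/
theorem integral_funCalc (hΛ : WaveHypothesis Λ) {f : ℝ → ℝ → ℝ} {C : ℝ} (hC : 0 ≤ C)
    (hf : ∀ s μ, |f s μ| ≤ C) (hc : ∀ μ, Continuous fun s => f s μ) (t : ℝ) (x : U) :
    ∫ s in (0 : ℝ)..t, funCalc Λ (f s) x = funCalc Λ (fun μ => ∫ s in (0 : ℝ)..t, f s μ) x := by
  have hb : ∀ s, BddOnEigs Λ (f s) := fun s => .of_le (hf s)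
  have hi : ∀ y, IntervalIntegrable (fun s => funCalc Λ (f s) y) volume 0 t := fun y =>
    (continuous_funCalc hΛ hC hf hc y).intervalIntegrable _ _
  let M : U →ₗ[ℝ] U :=
    { toFun := fun y => ∫ s in (0 : ℝ)..t, funCalc Λ (f s) y
      map_add' := fun y z => by
        simp only [map_add]; exact intervalIntegral.integral_add (hi y) (hi z)
      map_smul' := fun c y => by
        simp only [map_smul]; exact intervalIntegral.integral_smul c _ }
  let M' : U →L[ℝ] U := M.mkContinuous (C * |t - 0|) fun y => by
    refine (intervalIntegral.norm_integral_le_of_norm_le_const (C := C * ‖y‖)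
      fun s _ => norm_funCalc_apply_le hΛ hC (fun μ _ => hf s μ) y).trans_eq ?_
    ring
  have : funCalc Λ (fun μ => ∫ s in (0 : ℝ)..t, f s μ) = M' := by
    refine funCalc_unique hΛ fun μ u hu => ?_
    change ∫ s in (0 : ℝ)..t, funCalc Λ (f s) u = _
    simp only [fun s => funCalc_eigenvector hΛ (hb s) hu]
    exact intervalIntegral.integral_smul_const _ _
  rw [this]; rfl

end FunctionalCalculus

/-! ### Scalar estimates for a single oscillator of frequency `ω`. -/

section Scalars

/-- The difference of the two sides vanishes at `0` and has derivative `2 (1 - cos x)²`. The use is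
the equivalent form `x - sin x cos x ≤ 4 (x - sin x)`. -/
theorem three_mul_sub_sin_ge {x : ℝ} (hx : 0 ≤ x) :
    Real.sin x * (1 - Real.cos x) ≤ 3 * (x - Real.sin x) := by
  let F : ℝ → ℝ := fun x => 3 * (x - Real.sin x) - Real.sin x * (1 - Real.cos x)
  have hd : ∀ x, HasDerivAt F (2 * (1 - Real.cos x) ^ 2) x := by
    intro x
    have h := (((hasDerivAt_id x).sub (Real.hasDerivAt_sin x)).const_mul 3).sub
      ((Real.hasDerivAt_sin x).mul ((Real.hasDerivAt_cos x).const_sub 1))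
    refine h.congr_deriv ?_
    nlinarith [Real.sin_sq_add_cos_sq x]
  have hm : Monotone F := monotone_of_hasDerivAt_nonneg hd fun x => by
    simp only [Pi.zero_apply]; positivity
  have h0 := hm hx
  simp only [F, Real.sin_zero] at h0
  linarith

/-- `x - sin x` is cubic near `0` and linear at infinity; the factor `1 + x²` covers both regimes.
-/
theorem cube_le_mul_sub_sin {x : ℝ} (hx : 0 ≤ x) :
    x ^ 3 ≤ 54 * (1 + x ^ 2) * (x - Real.sin x) := by
  have hsub : 0 ≤ x - Real.sin x := sub_nonneg.mpr (Real.sin_le hx)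
  rcases le_total x 2 with h2 | h2
  · have hpi := Real.pi_gt_three
    have hpi4 := Real.pi_le_four
    -- Since `3 sin (x/3) ≤ x`, the triple angle formula gives `x - sin x ≥ 4 sin³(x/3)`. Jordan's
    -- inequality with `2/π ≥ 1/2` then bounds this below by `4 (x/6)³ = x³/54`.
    have h3 : Real.sin x = 3 * Real.sin (x / 3) - 4 * Real.sin (x / 3) ^ 3 := by
      rw [← Real.sin_three_mul]; congr 1; ring
    have hle : Real.sin (x / 3) ≤ x / 3 := Real.sin_le (by positivity)
    have hge : x / 6 ≤ Real.sin (x / 3) := by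
      refine le_trans ?_ (Real.mul_le_sin (by positivity) (by linarith))
      have : 1 / 2 ≤ 2 / Real.pi := by
        rw [div_le_div_iff₀ (by norm_num) (by positivity)]; linarith
      nlinarith
    have hcube : (x / 6) ^ 3 ≤ Real.sin (x / 3) ^ 3 := by gcongr
    nlinarith [mul_nonneg (sq_nonneg x) hsub]
  · have h1 := Real.sin_le_one x
    have : x ≤ 2 * (x - Real.sin x) := by linarith
    nlinarith [mul_le_mul_of_nonneg_left this (sq_nonneg x)]

theorem half_le_add_sin {x : ℝ} (hx : 0 ≤ x) : x / 2 ≤ x + Real.sin x := by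
  rcases le_total x Real.pi with h | h
  · linarith [Real.sin_nonneg_of_nonneg_of_le_pi hx h]
  · linarith [Real.neg_one_le_sin x, Real.pi_gt_three]

/-- `∫_0^t sin² (ω s) ds`. -/
def intSinSq (t ω : ℝ) : ℝ := (t - Real.sin (ω * t) * Real.cos (ω * t) / ω) / 2

/-- `∫_0^t cos² (ω s) ds`. -/
def intCosSq (t ω : ℝ) : ℝ := (t + Real.sin (ω * t) * Real.cos (ω * t) / ω) / 2

/-- `∫_0^t sin (ω s) cos (ω s) ds`. -/
def intSinCos (t ω : ℝ) : ℝ := Real.sin (ω * t) ^ 2 / (2 * ω)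

/-- The determinant of the Gramian of a single oscillator. -/
def gramDet (t ω : ℝ) : ℝ := (t ^ 2 - Real.sin (ω * t) ^ 2 / ω ^ 2) / 4

variable {t ω : ℝ}

theorem integral_sin_sq_mul (hω : 0 < ω) :
    ∫ s in (0 : ℝ)..t, Real.sin (ω * s) * Real.sin (ω * s) = intSinSq t ω := by
  have := intervalIntegral.integral_comp_mul_left (a := 0) (b := t)
    (fun s => Real.sin s ^ 2) hω.ne'
  simp only [← sq]
  rw [this, integral_sin_sq, intSinSq, smul_eq_mul]
  simp only [mul_zero, Real.sin_zero, zero_mul]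
  field_simp
  ring

theorem integral_cos_sq_mul (hω : 0 < ω) :
    ∫ s in (0 : ℝ)..t, Real.cos (ω * s) * Real.cos (ω * s) = intCosSq t ω := by
  have := intervalIntegral.integral_comp_mul_left (a := 0) (b := t)
    (fun s => Real.cos s ^ 2) hω.ne'
  simp only [← sq]
  rw [this, integral_cos_sq, intCosSq, smul_eq_mul]
  simp only [mul_zero, Real.sin_zero, Real.cos_zero]
  field_simp
  ring

theorem integral_sin_mul_cos_mul (hω : 0 < ω) :
    ∫ s in (0 : ℝ)..t, Real.sin (ω * s) * Real.cos (ω * s) = intSinCos t ω := by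
  have := intervalIntegral.integral_comp_mul_left (a := 0) (b := t)
    (fun s => Real.sin s * Real.cos s) hω.ne'
  rw [this, integral_sin_mul_cos₁, intSinCos, smul_eq_mul]
  simp only [mul_zero, Real.sin_zero]
  field_simp
  ring

theorem intSinSq_mul_intCosSq_sub (hω : 0 < ω) :
    intSinSq t ω * intCosSq t ω - intSinCos t ω * intSinCos t ω = gramDet t ω := by
  simp only [intSinSq, intCosSq, intSinCos, gramDet]
  have hc : Real.cos (ω * t) ^ 2 = 1 - Real.sin (ω * t) ^ 2 := by
    linarith [Real.sin_sq_add_cos_sq (ω * t)]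
  generalize Real.sin (ω * t) = σ at hc ⊢
  generalize Real.cos (ω * t) = γ at hc ⊢
  field_simp
  ring_nf
  rw [hc]
  ring

/-- With `τ = ωt` the determinant factors as `4 ω² D = (τ + sin τ)(τ - sin τ)`, and the first factor
is at least `τ/2`. -/
theorem gramDet_lower (hω : 0 < ω) (ht : 0 < t) :
    ω * t * (ω * t - Real.sin (ω * t)) ≤ 8 * ω ^ 2 * gramDet t ω := by
  have hτ : 0 ≤ ω * t := by positivity
  have h1 := half_le_add_sin hτ
  have h2 : 0 ≤ ω * t - Real.sin (ω * t) := sub_nonneg.mpr (Real.sin_le hτ)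
  have h3 : 8 * ω ^ 2 * gramDet t ω =
      2 * ((ω * t + Real.sin (ω * t)) * (ω * t - Real.sin (ω * t))) := by
    rw [gramDet]; field_simp; ring
  rw [h3]
  nlinarith [mul_le_mul_of_nonneg_right h1 h2]

theorem gramDet_pos (hω : 0 < ω) (ht : 0 < t) : 0 < gramDet t ω := by
  have hτ : 0 < ω * t := by positivity
  have h2 : 0 < ω * t - Real.sin (ω * t) := sub_pos.mpr (Real.sin_lt hτ)
  have h3 := gramDet_lower hω ht
  have h4 : 0 < 8 * ω ^ 2 * gramDet t ω := lt_of_lt_of_le (by positivity) h3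
  exact pos_of_mul_pos_right h4 (by positivity)

/-- Numerator and determinant degenerate through the same factor `τ - sin τ`, where `τ = ωt`. It
cancels, and the bound depends on neither `ω` nor an upper bound for `t`. -/
theorem intSinSq_div_gramDet_le (hω : 0 < ω) (ht : 0 < t) :
    intSinSq t ω / gramDet t ω ≤ 16 / t := by
  have hτ : 0 ≤ ω * t := by positivity
  rw [div_le_div_iff₀ (gramDet_pos hω ht) ht]
  have h1 := three_mul_sub_sin_ge hτ
  have h2 := gramDet_lower hω ht
  have h3 : 2 * ω * intSinSq t ω = ω * t - Real.sin (ω * t) * Real.cos (ω * t) := by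
    rw [intSinSq]; field_simp
  have h4 : 2 * ω * intSinSq t ω ≤ 4 * (ω * t - Real.sin (ω * t)) := by rw [h3]; linarith
  have h5 := mul_le_mul_of_nonneg_left h4 hτ
  have h6 : ω ^ 2 * (intSinSq t ω * t) ≤ ω ^ 2 * (16 * gramDet t ω) := by nlinarith
  exact le_of_mul_le_mul_left h6 (by positivity)

/-- For small `ωt` the determinant behaves like `ω² t⁴ / 12`, which calls for the lower bound on
`ω²`; for large `ωt` it behaves like `t²/4`, which calls for `t ≤ T`. The constant is `432 = 54 ·
8`, from `cube_le_mul_sub_sin` and `gramDet_lower`. -/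
theorem pow_four_le_gramDet {m T : ℝ} (hm : 0 < m) (hmω : m ≤ ω ^ 2) (hω : 0 < ω) (ht : 0 < t)
    (htT : t ≤ T) : t ^ 4 ≤ 432 * (1 / m + T ^ 2) * gramDet t ω := by
  have hτ : 0 ≤ ω * t := by positivity
  have hD := gramDet_pos hω ht
  have h1 := mul_le_mul_of_nonneg_left (cube_le_mul_sub_sin hτ) hτ
  have h2 := mul_le_mul_of_nonneg_left (gramDet_lower hω ht)
    (show 0 ≤ 54 * (1 + (ω * t) ^ 2) by positivity)
  have h3 : ω ^ 4 * t ^ 4 ≤ ω ^ 4 * (432 * (1 / ω ^ 2 + t ^ 2) * gramDet t ω) := by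
    have : ω ^ 4 * (432 * (1 / ω ^ 2 + t ^ 2) * gramDet t ω) =
        54 * (1 + (ω * t) ^ 2) * (8 * ω ^ 2 * gramDet t ω) := by field_simp; ring
    rw [this]
    nlinarith
  refine (le_of_mul_le_mul_left h3 (by positivity)).trans ?_
  gcongr

theorem abs_sin_mul_cos_div_le (hω : 0 < ω) (ht : 0 < t) :
    |Real.sin (ω * t) * Real.cos (ω * t) / ω| ≤ t := by
  rw [abs_div, abs_mul, abs_of_pos hω, div_le_iff₀ hω]
  have h1 : |Real.sin (ω * t)| ≤ ω * t :=
    Real.abs_sin_le_abs.trans_eq (abs_of_nonneg (by positivity))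
  nlinarith [Real.abs_cos_le_one (ω * t), abs_nonneg (Real.sin (ω * t)),
    abs_nonneg (Real.cos (ω * t))]

theorem intSinSq_mem (hω : 0 < ω) (ht : 0 < t) : 0 ≤ intSinSq t ω ∧ intSinSq t ω ≤ t := by
  have := abs_le.mp (abs_sin_mul_cos_div_le hω ht)
  constructor <;> rw [intSinSq] <;> linarith

theorem intCosSq_mem (hω : 0 < ω) (ht : 0 < t) : 0 ≤ intCosSq t ω ∧ intCosSq t ω ≤ t := by
  have := abs_le.mp (abs_sin_mul_cos_div_le hω ht)
  constructor <;> rw [intCosSq] <;> linarith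

/-- Positivity of the determinant bounds the square of the off-diagonal entry by the product of the
diagonal ones, each at most `t`. -/
theorem abs_intSinCos_le (hω : 0 < ω) (ht : 0 < t) : |intSinCos t ω| ≤ t := by
  have h := intSinSq_mul_intCosSq_sub (t := t) hω
  have h0 := gramDet_pos hω ht
  obtain ⟨h1, h2⟩ := intSinSq_mem hω ht
  obtain ⟨h3, h4⟩ := intCosSq_mem hω ht
  refine abs_le_of_sq_le_sq ?_ ht.le
  nlinarith [mul_le_mul h2 h4 h3 ht.le]

/-- The bottom right entry of the conjugate of the inverse Gramian by the rotation. -/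
theorem conj_inverse_gram (hω : 0 < ω) :
    Real.sin (ω * t) * Real.sin (ω * t) * intCosSq t ω
      - 2 * (Real.sin (ω * t) * Real.cos (ω * t)) * intSinCos t ω
      + Real.cos (ω * t) * Real.cos (ω * t) * intSinSq t ω = intSinSq t ω := by
  simp only [intSinSq, intCosSq, intSinCos]
  have hc : Real.cos (ω * t) ^ 2 = 1 - Real.sin (ω * t) ^ 2 := by
    linarith [Real.sin_sq_add_cos_sq (ω * t)]
  generalize Real.sin (ω * t) = σ at hc ⊢
  generalize Real.cos (ω * t) = γ at hc ⊢
  have hc3 : γ ^ 3 = γ * (1 - σ ^ 2) := by rw [← hc]; ring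
  field_simp
  ring_nf
  rw [hc3, hc]
  ring

/-- A positive semidefinite real `2 × 2` matrix has a positive semidefinite square root. -/
theorem exists_sqrt_two_by_two {a b d : ℝ} (ha : 0 ≤ a) (hd : 0 ≤ d) (h : b * b ≤ a * d) :
    ∃ a' b' d' : ℝ, 0 ≤ a' ∧ 0 ≤ d' ∧ b' * b' ≤ a' * d' ∧ a' * a' + b' * b' = a ∧
      a' * b' + b' * d' = b ∧ b' * b' + d' * d' = d := by
  -- By Cayley–Hamilton the root of a matrix `M` is `(M + δ) / σ`, where `δ = √(det M)` and `σ =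
  -- √(tr M + 2δ)`. If `tr M + 2δ = 0`, then `M = 0`.
  set δ := √(a * d - b * b) with hδ
  have hδ0 : 0 ≤ δ := Real.sqrt_nonneg _
  have hδ2 : δ * δ = a * d - b * b := Real.mul_self_sqrt (by linarith)
  rcases (show 0 ≤ a + d + 2 * δ by positivity).eq_or_lt with h0 | h0
  · have ha0 : a = 0 := by linarith
    have hd0 : d = 0 := by linarith
    have hb0 : b = 0 := by subst ha0; nlinarith
    exact ⟨0, 0, 0, by simp [ha0, hd0, hb0]⟩
  · set σ := √(a + d + 2 * δ) with hσ
    have hσ0 : 0 < σ := Real.sqrt_pos.mpr h0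
    have hσ2 : σ ^ 2 = a + d + 2 * δ := Real.sq_sqrt h0.le
    refine ⟨(a + δ) / σ, b / σ, (d + δ) / σ, by positivity, by positivity, ?_, ?_, ?_, ?_⟩
    · rw [div_mul_div_comm, div_mul_div_comm]
      refine div_le_div_of_nonneg_right ?_ (by positivity)
      nlinarith [mul_nonneg ha hδ0, mul_nonneg hd hδ0]
    · field_simp; rw [hσ2]; nlinarith
    · field_simp; rw [hσ2]; nlinarith
    · field_simp; rw [hσ2]; nlinarith

end Scalars

/-! ### `2 × 2` matrices of functions of `Λ` acting on `H`. -/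

section BlockOperators

variable {U : Type*} [NormedAddCommGroup U] [InnerProductSpace ℝ U] [CompleteSpace U]

/-- The first coordinate of `H = U × V'`. -/
def posCoord (Λ : U →ₗ.[ℝ] U) : StateSpace Λ →L[ℝ] U :=
  ContinuousLinearMap.fst ℝ U (DualV Λ) ∘L
    (WithLp.prodContinuousLinearEquiv 2 ℝ U (DualV Λ)).toContinuousLinearMap

/-- The second coordinate of `H = U × V'`, identified with an element of `U` by `Λ^{-1/2}`. -/
def velCoord (Λ : U →ₗ.[ℝ] U) : StateSpace Λ →L[ℝ] U :=
  invSqrtV Λ ∘L ContinuousLinearMap.snd ℝ U (DualV Λ) ∘L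
    (WithLp.prodContinuousLinearEquiv 2 ℝ U (DualV Λ)).toContinuousLinearMap

/-- The state with given coordinates. -/
def ofCoords (Λ : U →ₗ.[ℝ] U) : U × U →L[ℝ] StateSpace Λ :=
  (WithLp.prodContinuousLinearEquiv 2 ℝ U (DualV Λ)).symm.toContinuousLinearMap ∘L
    (ContinuousLinearMap.fst ℝ U U).prod (sqrtV Λ ∘L ContinuousLinearMap.snd ℝ U U)

variable {Λ : U →ₗ.[ℝ] U}

theorem velCoord_ofCoords (hΛ : WaveHypothesis Λ) (p q : U) :
    velCoord Λ (ofCoords Λ (p, q)) = q := invSqrtV_sqrtV hΛ q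

set_option linter.unusedSectionVars false in
theorem posCoord_G (a : DualV Λ) : posCoord Λ (G Λ a) = 0 := rfl

theorem velCoord_G (a : DualV Λ) : velCoord Λ (G Λ a) = invSqrtV Λ a := rfl

theorem inner_invSqrtV (a b : DualV Λ) : ⟪invSqrtV Λ a, invSqrtV Λ b⟫_ℝ = ⟪a, b⟫_ℝ :=
  LinearIsometry.inner_map_map ⟨(invSqrtV Λ).toLinearMap, norm_invSqrtV Λ⟩ a b

theorem inner_eq_coords (x y : StateSpace Λ) :
    ⟪x, y⟫_ℝ = ⟪posCoord Λ x, posCoord Λ y⟫_ℝ + ⟪velCoord Λ x, velCoord Λ y⟫_ℝ := by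
  rw [WithLp.prod_inner_apply, ← inner_invSqrtV]; rfl

theorem norm_sq_eq_coords (x : StateSpace Λ) :
    ‖x‖ ^ 2 = ‖posCoord Λ x‖ ^ 2 + ‖velCoord Λ x‖ ^ 2 := by
  simp only [← real_inner_self_eq_norm_sq]; exact inner_eq_coords x x

theorem ext_coords {x y : StateSpace Λ} (hp : posCoord Λ x = posCoord Λ y)
    (hv : velCoord Λ x = velCoord Λ y) : x = y := by
  rw [← sub_eq_zero, ← norm_eq_zero, ← sq_eq_zero_iff, norm_sq_eq_coords, map_sub, map_sub, hp, hv]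
  simp

theorem norm_G (a : DualV Λ) : ‖G Λ a‖ = ‖a‖ := by
  rw [← sq_eq_sq₀ (norm_nonneg _) (norm_nonneg _), norm_sq_eq_coords, posCoord_G, velCoord_G,
    norm_invSqrtV]
  simp

theorem invSqrtV_adjoint_G (x : StateSpace Λ) :
    invSqrtV Λ ((G Λ).adjoint x) = velCoord Λ x := by
  have : (G Λ).adjoint x = (WithLp.prodContinuousLinearEquiv 2 ℝ U (DualV Λ) x).2 := by
    refine ext_inner_right ℝ fun a => ?_
    rw [ContinuousLinearMap.adjoint_inner_left, inner_eq_coords, posCoord_G, velCoord_G,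
      inner_zero_right, zero_add]
    exact inner_invSqrtV _ _
  rw [this]; rfl

/-- The operator on `H` given in coordinates by a `2 × 2` matrix of functions of `Λ`. -/
def blockOp (Λ : U →ₗ.[ℝ] U) (a b c d : ℝ → ℝ) : StateSpace Λ →L[ℝ] StateSpace Λ :=
  ofCoords Λ ∘L
    (funCalc Λ a ∘L posCoord Λ + funCalc Λ b ∘L velCoord Λ).prod
      (funCalc Λ c ∘L posCoord Λ + funCalc Λ d ∘L velCoord Λ)

variable {a b c d a' b' c' d' : ℝ → ℝ}

theorem posCoord_blockOp (x : StateSpace Λ) :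
    posCoord Λ (blockOp Λ a b c d x) =
      funCalc Λ a (posCoord Λ x) + funCalc Λ b (velCoord Λ x) := rfl

theorem velCoord_blockOp (hΛ : WaveHypothesis Λ) (x : StateSpace Λ) :
    velCoord Λ (blockOp Λ a b c d x) =
      funCalc Λ c (posCoord Λ x) + funCalc Λ d (velCoord Λ x) := velCoord_ofCoords hΛ _ _

theorem blockOp_congr (hΛ : WaveHypothesis Λ) (ha : BddOnEigs Λ a) (hb : BddOnEigs Λ b)
    (hc : BddOnEigs Λ c) (hd : BddOnEigs Λ d)
    (haa : ∀ μ ∈ eigenvalueSet Λ, a μ = a' μ) (hbb : ∀ μ ∈ eigenvalueSet Λ, b μ = b' μ)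
    (hcc : ∀ μ ∈ eigenvalueSet Λ, c μ = c' μ) (hdd : ∀ μ ∈ eigenvalueSet Λ, d μ = d' μ) :
    blockOp Λ a b c d = blockOp Λ a' b' c' d' := by
  rw [blockOp, blockOp, funCalc_congr hΛ ha haa, funCalc_congr hΛ hb hbb, funCalc_congr hΛ hc hcc,
    funCalc_congr hΛ hd hdd]

theorem blockOp_comp (hΛ : WaveHypothesis Λ) (ha : BddOnEigs Λ a) (hb : BddOnEigs Λ b)
    (hc : BddOnEigs Λ c) (hd : BddOnEigs Λ d) (ha' : BddOnEigs Λ a') (hb' : BddOnEigs Λ b')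
    (hc' : BddOnEigs Λ c') (hd' : BddOnEigs Λ d') :
    blockOp Λ a b c d ∘L blockOp Λ a' b' c' d' =
      blockOp Λ (fun μ => a μ * a' μ + b μ * c' μ) (fun μ => a μ * b' μ + b μ * d' μ)
        (fun μ => c μ * a' μ + d μ * c' μ) (fun μ => c μ * b' μ + d μ * d' μ) := by
  ext1 x
  refine ext_coords ?_ ?_
  · rw [ContinuousLinearMap.comp_apply, posCoord_blockOp, posCoord_blockOp, posCoord_blockOp,
      velCoord_blockOp hΛ, funCalc_add hΛ (ha.mul ha') (hb.mul hc'),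
      funCalc_add hΛ (ha.mul hb') (hb.mul hd'), funCalc_mul hΛ ha ha', funCalc_mul hΛ hb hc',
      funCalc_mul hΛ ha hb', funCalc_mul hΛ hb hd', map_add, map_add]
    abel
  · rw [ContinuousLinearMap.comp_apply, velCoord_blockOp hΛ, velCoord_blockOp hΛ,
      posCoord_blockOp,
      velCoord_blockOp hΛ, funCalc_add hΛ (hc.mul ha') (hd.mul hc'),
      funCalc_add hΛ (hc.mul hb') (hd.mul hd'), funCalc_mul hΛ hc ha', funCalc_mul hΛ hd hc',
      funCalc_mul hΛ hc hb', funCalc_mul hΛ hd hd', map_add, map_add]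
    abel

theorem blockOp_one (hΛ : WaveHypothesis Λ) :
    blockOp Λ (fun _ => 1) (fun _ => 0) (fun _ => 0) (fun _ => 1) =
      ContinuousLinearMap.id ℝ (StateSpace Λ) := by
  ext1 x
  refine ext_coords ?_ ?_
  · rw [posCoord_blockOp, funCalc_const hΛ, funCalc_const hΛ]; simp
  · rw [velCoord_blockOp hΛ, funCalc_const hΛ, funCalc_const hΛ]; simp

theorem blockOp_adjoint (hΛ : WaveHypothesis Λ) (ha : BddOnEigs Λ a) (hb : BddOnEigs Λ b)
    (hc : BddOnEigs Λ c) (hd : BddOnEigs Λ d) :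
    (blockOp Λ a b c d).adjoint = blockOp Λ a c b d := by
  refine ((ContinuousLinearMap.eq_adjoint_iff _ _).mpr fun x y => ?_).symm
  simp only [inner_eq_coords, posCoord_blockOp, velCoord_blockOp hΛ, inner_add_left,
    inner_add_right, funCalc_inner hΛ ha, funCalc_inner hΛ hb, funCalc_inner hΛ hc,
    funCalc_inner hΛ hd]
  ring

theorem G_comp_adjoint (hΛ : WaveHypothesis Λ) :
    G Λ ∘L (G Λ).adjoint = blockOp Λ (fun _ => 0) (fun _ => 0) (fun _ => 0) (fun _ => 1) := by
  ext1 x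
  refine ext_coords ?_ ?_
  · rw [posCoord_blockOp, funCalc_const hΛ, funCalc_const hΛ, ContinuousLinearMap.comp_apply,
      posCoord_G]
    simp
  · rw [velCoord_blockOp hΛ, funCalc_const hΛ, funCalc_const hΛ, ContinuousLinearMap.comp_apply,
      velCoord_G, invSqrtV_adjoint_G]
    simp

theorem norm_blockOp_apply_le (hΛ : WaveHypothesis Λ) {M : ℝ} (hM : 0 ≤ M)
    (ha : ∀ μ ∈ eigenvalueSet Λ, |a μ| ≤ M) (hb : ∀ μ ∈ eigenvalueSet Λ, |b μ| ≤ M)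
    (hc : ∀ μ ∈ eigenvalueSet Λ, |c μ| ≤ M) (hd : ∀ μ ∈ eigenvalueSet Λ, |d μ| ≤ M)
    (x : StateSpace Λ) : ‖blockOp Λ a b c d x‖ ≤ 2 * M * ‖x‖ := by
  refine (sq_le_sq₀ (norm_nonneg _) (by positivity)).mp ?_
  rw [norm_sq_eq_coords, posCoord_blockOp, velCoord_blockOp hΛ]
  have h1 := (norm_add_le _ _).trans (add_le_add
    (norm_funCalc_apply_le hΛ hM ha (posCoord Λ x)) (norm_funCalc_apply_le hΛ hM hb (velCoord Λ x)))
  have h2 := (norm_add_le _ _).trans (add_le_add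
    (norm_funCalc_apply_le hΛ hM hc (posCoord Λ x)) (norm_funCalc_apply_le hΛ hM hd (velCoord Λ x)))
  have h3 := pow_le_pow_left₀ (norm_nonneg _) h1 2
  have h4 := pow_le_pow_left₀ (norm_nonneg _) h2 2
  have h5 := norm_sq_eq_coords x
  have h6 : (2 * M * ‖x‖) ^ 2 = 4 * M ^ 2 * (‖posCoord Λ x‖ ^ 2 + ‖velCoord Λ x‖ ^ 2) := by
    rw [← h5]; ring
  rw [h6]
  nlinarith [mul_nonneg (sq_nonneg M) (sq_nonneg (‖posCoord Λ x‖ - ‖velCoord Λ x‖))]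

/-- A block operator with positive semidefinite symbol has a square root of the same kind. -/
theorem exists_sqrt_blockOp (hΛ : WaveHypothesis Λ) (ha : BddOnEigs Λ a)
    (hd : BddOnEigs Λ d) (ha0 : ∀ μ ∈ eigenvalueSet Λ, 0 ≤ a μ)
    (hd0 : ∀ μ ∈ eigenvalueSet Λ, 0 ≤ d μ)
    (hdet : ∀ μ ∈ eigenvalueSet Λ, b μ * b μ ≤ a μ * d μ) :
    ∃ a' b' d' : ℝ → ℝ, BddOnEigs Λ a' ∧ BddOnEigs Λ b' ∧ BddOnEigs Λ d' ∧
      (∀ μ ∈ eigenvalueSet Λ, 0 ≤ a' μ) ∧ (∀ μ ∈ eigenvalueSet Λ, 0 ≤ d' μ) ∧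
      (∀ μ ∈ eigenvalueSet Λ, b' μ * b' μ ≤ a' μ * d' μ) ∧
      blockOp Λ a' b' b' d' ∘L blockOp Λ a' b' b' d' = blockOp Λ a b b d := by
  have h : ∀ μ, ∃ r : ℝ × ℝ × ℝ, μ ∈ eigenvalueSet Λ → 0 ≤ r.1 ∧ 0 ≤ r.2.2 ∧
      r.2.1 * r.2.1 ≤ r.1 * r.2.2 ∧ r.1 * r.1 + r.2.1 * r.2.1 = a μ ∧
      r.1 * r.2.1 + r.2.1 * r.2.2 = b μ ∧ r.2.1 * r.2.1 + r.2.2 * r.2.2 = d μ := by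
    intro μ
    by_cases hμ : μ ∈ eigenvalueSet Λ
    · obtain ⟨x, y, z, h⟩ := exists_sqrt_two_by_two (ha0 μ hμ) (hd0 μ hμ) (hdet μ hμ)
      exact ⟨(x, y, z), fun _ => h⟩
    -- The root is chosen separately at each `μ`; off the eigenvalues any value will do, since the
    -- calculus requires no regularity of the symbol.
    · exact ⟨(0, 0, 0), fun h => (hμ h).elim⟩
  choose r hr using h
  obtain ⟨A, hA⟩ := ha
  obtain ⟨D, hD⟩ := hd
  have key : ∀ x y C : ℝ, x * x + y * y ≤ C → |x| ≤ 1 + C := fun x y C h =>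
    abs_le_of_sq_le_sq (by nlinarith [mul_self_nonneg x, mul_self_nonneg y])
      (by nlinarith [mul_self_nonneg x, mul_self_nonneg y])
  have h1 : BddOnEigs Λ fun μ => (r μ).1 := ⟨1 + A, fun μ hμ =>
    key _ (r μ).2.1 _ ((hr μ hμ).2.2.2.1.trans_le ((le_abs_self _).trans (hA μ hμ)))⟩
  have h2 : BddOnEigs Λ fun μ => (r μ).2.1 := ⟨1 + D, fun μ hμ =>
    key _ (r μ).2.2 _ ((hr μ hμ).2.2.2.2.2.trans_le ((le_abs_self _).trans (hD μ hμ)))⟩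
  have h3 : BddOnEigs Λ fun μ => (r μ).2.2 := ⟨1 + D, fun μ hμ =>
    key _ (r μ).2.1 _ ((add_comm _ _).trans_le
      ((hr μ hμ).2.2.2.2.2.trans_le ((le_abs_self _).trans (hD μ hμ))))⟩
  refine ⟨_, _, _, h1, h2, h3, fun μ hμ => (hr μ hμ).1, fun μ hμ => (hr μ hμ).2.1,
    fun μ hμ => (hr μ hμ).2.2.1, ?_⟩
  rw [blockOp_comp hΛ h1 h2 h2 h3 h1 h2 h2 h3]
  refine blockOp_congr hΛ ((h1.mul h1).add (h2.mul h2)) ((h1.mul h2).add (h2.mul h3))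
    ((h2.mul h1).add (h3.mul h2)) ((h2.mul h2).add (h3.mul h3)) (fun μ hμ => (hr μ hμ).2.2.2.1)
    (fun μ hμ => (hr μ hμ).2.2.2.2.1) (fun μ hμ => ?_) (fun μ hμ => (hr μ hμ).2.2.2.2.2)
  rw [← (hr μ hμ).2.2.2.2.1]; ring

/-- Positivity of the root comes from extracting a root twice: if `S = R²` with `R` a symmetric
block operator, then `S = R^* R`. -/
theorem exists_isPositive_sqrt_blockOp (hΛ : WaveHypothesis Λ) (ha : BddOnEigs Λ a)
    (hd : BddOnEigs Λ d) (ha0 : ∀ μ ∈ eigenvalueSet Λ, 0 ≤ a μ)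
    (hd0 : ∀ μ ∈ eigenvalueSet Λ, 0 ≤ d μ)
    (hdet : ∀ μ ∈ eigenvalueSet Λ, b μ * b μ ≤ a μ * d μ) :
    ∃ S : StateSpace Λ →L[ℝ] StateSpace Λ, S.IsPositive ∧ S ∘L S = blockOp Λ a b b d := by
  obtain ⟨a', b', d', ha', -, hd', ha0', hd0', hdet', h⟩ :=
    exists_sqrt_blockOp hΛ ha hd ha0 hd0 hdet
  obtain ⟨a₂, b₂, d₂, ha₂, hb₂, hd₂, -, -, -, h₂⟩ :=
    exists_sqrt_blockOp hΛ ha' hd' ha0' hd0' hdet'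
  refine ⟨_, ?_, h⟩
  rw [← h₂]
  have := ContinuousLinearMap.isPositive_adjoint_comp_self (blockOp Λ a₂ b₂ b₂ d₂)
  rwa [blockOp_adjoint hΛ ha₂ hb₂ hb₂ hd₂] at this

theorem continuous_blockOp (hΛ : WaveHypothesis Λ) {a b c d : ℝ → ℝ → ℝ} {C : ℝ} (hC : 0 ≤ C)
    (ha : ∀ s μ, |a s μ| ≤ C) (hb : ∀ s μ, |b s μ| ≤ C) (hc : ∀ s μ, |c s μ| ≤ C)
    (hd : ∀ s μ, |d s μ| ≤ C) (hac : ∀ μ, Continuous fun s => a s μ)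
    (hbc : ∀ μ, Continuous fun s => b s μ) (hcc : ∀ μ, Continuous fun s => c s μ)
    (hdc : ∀ μ, Continuous fun s => d s μ) (x : StateSpace Λ) :
    Continuous fun s => blockOp Λ (a s) (b s) (c s) (d s) x :=
  (ofCoords Λ).continuous.comp <|
    ((continuous_funCalc hΛ hC ha hac _).add (continuous_funCalc hΛ hC hb hbc _)).prodMk
      ((continuous_funCalc hΛ hC hc hcc _).add (continuous_funCalc hΛ hC hd hdc _))

theorem integral_blockOp (hΛ : WaveHypothesis Λ) {a b c d : ℝ → ℝ → ℝ} {C : ℝ} (hC : 0 ≤ C)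
    (ha : ∀ s μ, |a s μ| ≤ C) (hb : ∀ s μ, |b s μ| ≤ C) (hc : ∀ s μ, |c s μ| ≤ C)
    (hd : ∀ s μ, |d s μ| ≤ C) (hac : ∀ μ, Continuous fun s => a s μ)
    (hbc : ∀ μ, Continuous fun s => b s μ) (hcc : ∀ μ, Continuous fun s => c s μ)
    (hdc : ∀ μ, Continuous fun s => d s μ) (t : ℝ) (x : StateSpace Λ) :
    ∫ s in (0 : ℝ)..t, blockOp Λ (a s) (b s) (c s) (d s) x =
      blockOp Λ (fun μ => ∫ s in (0 : ℝ)..t, a s μ) (fun μ => ∫ s in (0 : ℝ)..t, b s μ)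
        (fun μ => ∫ s in (0 : ℝ)..t, c s μ) (fun μ => ∫ s in (0 : ℝ)..t, d s μ) x := by
  have hi := (continuous_blockOp hΛ hC ha hb hc hd hac hbc hcc hdc x).intervalIntegrable
    (μ := volume) 0 t
  refine ext_coords ?_ ?_
  · rw [← ContinuousLinearMap.intervalIntegral_comp_comm _ hi]
    simp only [posCoord_blockOp]
    rw [intervalIntegral.integral_add
      ((continuous_funCalc hΛ hC ha hac _).intervalIntegrable _ _)
      ((continuous_funCalc hΛ hC hb hbc _).intervalIntegrable _ _),
      integral_funCalc hΛ hC ha hac, integral_funCalc hΛ hC hb hbc]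
  · rw [← ContinuousLinearMap.intervalIntegral_comp_comm _ hi]
    simp only [velCoord_blockOp hΛ]
    rw [intervalIntegral.integral_add
      ((continuous_funCalc hΛ hC hc hcc _).intervalIntegrable _ _)
      ((continuous_funCalc hΛ hC hd hdc _).intervalIntegrable _ _),
      integral_funCalc hΛ hC hc hcc, integral_funCalc hΛ hC hd hdc]

end BlockOperators

/-! ### Square roots, strong integrals and pseudo-inverses under abstract hypotheses. -/

section General

variable {E : Type*} [NormedAddCommGroup E] [InnerProductSpace ℝ E]

theorem posSqrt_spec {T : E →L[ℝ] E} (h : ∃ S : E →L[ℝ] E, S.IsPositive ∧ S ∘L S = T) :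
    (posSqrt T).IsPositive ∧ posSqrt T ∘L posSqrt T = T := by
  rw [posSqrt, dif_pos h]; exact h.choose_spec

theorem strongIntegral_eq {Φ : ℝ → E →L[ℝ] E} {a b : ℝ} {T : E →L[ℝ] E}
    (hT : ∀ x : E, IntervalIntegrable (fun s => Φ s x) volume a b ∧ T x = ∫ s in a..b, Φ s x) :
    strongIntegral Φ a b = T := by
  have h : ∃ T : E →L[ℝ] E, ∀ x : E,
      IntervalIntegrable (fun s => Φ s x) volume a b ∧ T x = ∫ s in a..b, Φ s x := ⟨T, hT⟩
  rw [strongIntegral, dif_pos h]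
  ext1 x
  rw [(h.choose_spec x).2, (hT x).2]

theorem pseudoInv_apply_of_injective {F : Type*} [NormedAddCommGroup F] [InnerProductSpace ℝ F]
    {T : E →L[ℝ] F} (hT : Function.Injective T) (y : E) : pseudoInv T (T y) = y := by
  have h : ∃ z : E, z ∈ (LinearMap.ker T.toLinearMap)ᗮ ∧ T z = T y := by
    refine ⟨y, ?_, rfl⟩
    rw [LinearMap.ker_eq_bot.mpr (by exact hT), Submodule.bot_orthogonal_eq_top]
    trivial
  rw [pseudoInv, dif_pos h]
  exact hT h.choose_spec.2

/-- For an invertible positive operator `T` with inverse `R`, the pseudo-inverse of `T^{1/2}`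
satisfies `‖T^{-1/2} x‖² = ⟪x, R x⟫`. -/
theorem pseudoInv_posSqrt {T R : E →L[ℝ] E}
    (h : ∃ S : E →L[ℝ] E, S.IsPositive ∧ S ∘L S = T) (hTR : ∀ x, T (R x) = x)
    (hRT : ∀ x, R (T x) = x) (x : E) :
    (∃ y, posSqrt T y = x) ∧ ‖pseudoInv (posSqrt T) x‖ ^ 2 = ⟪x, R x⟫_ℝ := by
  obtain ⟨hpos, hsq⟩ := posSqrt_spec h
  have hsq' : ∀ y, posSqrt T (posSqrt T y) = T y := fun y => by
    rw [← ContinuousLinearMap.comp_apply, hsq]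
  have hx : posSqrt T (posSqrt T (R x)) = x := by rw [hsq', hTR]
  have hinj : Function.Injective (posSqrt T) := fun y z hyz => by
    rw [← hRT y, ← hRT z, ← hsq', ← hsq', hyz]
  refine ⟨⟨_, hx⟩, ?_⟩
  have h1 : pseudoInv (posSqrt T) x = posSqrt T (R x) := by
    conv_lhs => rw [← hx]
    exact pseudoInv_apply_of_injective hinj _
  rw [h1, ← real_inner_self_eq_norm_sq]
  have h2 := hpos.isSymmetric (R x) (posSqrt T (R x))
  exact h2.trans (by rw [ContinuousLinearMap.coe_coe, hx, real_inner_comm])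

end General

/-! ### The wave group as a rotation, and the symbol of the Gramian. -/

section WaveGroup

variable {U : Type*} [NormedAddCommGroup U] [InnerProductSpace ℝ U] {Λ : U →ₗ.[ℝ] U}

theorem bddOnEigs_sin (t : ℝ) : BddOnEigs Λ fun μ => Real.sin (√μ * t) :=
  .of_le fun _ => Real.abs_sin_le_one _

theorem bddOnEigs_cos (t : ℝ) : BddOnEigs Λ fun μ => Real.cos (√μ * t) :=
  .of_le fun _ => Real.abs_cos_le_one _

variable [CompleteSpace U]

theorem waveGroup_eq_blockOp (hΛ : WaveHypothesis Λ) (t : ℝ) :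
    waveGroup Λ t = blockOp Λ (fun μ => Real.cos (√μ * t)) (fun μ => Real.sin (√μ * t))
      (fun μ => -Real.sin (√μ * t)) (fun μ => Real.cos (√μ * t)) := by
  ext1 x
  refine ext_coords ?_ ?_
  · rw [posCoord_blockOp]
    change _ + invSqrtV Λ (sqrtV Λ _) = _
    rw [invSqrtV_sqrtV hΛ]; rfl
  · rw [velCoord_blockOp hΛ, funCalc_neg hΛ (bddOnEigs_sin t)]
    change invSqrtV Λ (-(sqrtV Λ _) + sqrtV Λ _) = _
    rw [map_add, map_neg, invSqrtV_sqrtV hΛ, invSqrtV_sqrtV hΛ]; rfl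

theorem waveGroup_adjoint (hΛ : WaveHypothesis Λ) (t : ℝ) :
    (waveGroup Λ t).adjoint = blockOp Λ (fun μ => Real.cos (√μ * t))
      (fun μ => -Real.sin (√μ * t)) (fun μ => Real.sin (√μ * t))
      (fun μ => Real.cos (√μ * t)) := by
  rw [waveGroup_eq_blockOp hΛ, blockOp_adjoint hΛ (bddOnEigs_cos t) (bddOnEigs_sin t)
    (bddOnEigs_sin t).neg (bddOnEigs_cos t)]

theorem waveGroup_adjoint_comp_self (hΛ : WaveHypothesis Λ) (t : ℝ) :
    (waveGroup Λ t).adjoint ∘L waveGroup Λ t = ContinuousLinearMap.id ℝ (StateSpace Λ) := by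
  have hc := bddOnEigs_cos (Λ := Λ) t
  have hs := bddOnEigs_sin (Λ := Λ) t
  rw [waveGroup_adjoint hΛ, waveGroup_eq_blockOp hΛ, blockOp_comp hΛ hc hs.neg hs hc hc hs hs.neg hc,
    ← blockOp_one hΛ]
  congr 1 <;> ext μ <;> nlinarith [Real.sin_sq_add_cos_sq (√μ * t)]

theorem norm_waveGroup (hΛ : WaveHypothesis Λ) (t : ℝ) (x : StateSpace Λ) :
    ‖waveGroup Λ t x‖ = ‖x‖ :=
  (ContinuousLinearMap.norm_map_iff_adjoint_comp_self _).mpr (waveGroup_adjoint_comp_self hΛ t) x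

theorem continuous_waveGroup_apply (hΛ : WaveHypothesis Λ) (x : StateSpace Λ) :
    Continuous fun s => waveGroup Λ s x := by
  simp only [waveGroup_eq_blockOp hΛ]
  refine continuous_blockOp hΛ zero_le_one (fun _ _ => Real.abs_cos_le_one _)
    (fun _ _ => Real.abs_sin_le_one _) (fun _ _ => ?_) (fun _ _ => Real.abs_cos_le_one _)
    (fun _ => by fun_prop) (fun _ => by fun_prop) (fun _ => by fun_prop) (fun _ => by fun_prop) x
  rw [abs_neg]; exact Real.abs_sin_le_one _

theorem continuous_waveGroup_adjoint_apply (hΛ : WaveHypothesis Λ) (x : StateSpace Λ) :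
    Continuous fun s => (waveGroup Λ s).adjoint x := by
  simp only [waveGroup_adjoint hΛ]
  refine continuous_blockOp hΛ zero_le_one (fun _ _ => Real.abs_cos_le_one _)
    (fun _ _ => ?_) (fun _ _ => Real.abs_sin_le_one _) (fun _ _ => Real.abs_cos_le_one _)
    (fun _ => by fun_prop) (fun _ => by fun_prop) (fun _ => by fun_prop) (fun _ => by fun_prop) x
  rw [abs_neg]; exact Real.abs_sin_le_one _

/-- Strong continuity together with isometry gives joint continuity. This makes `s ↦ e^{(t-s)A} G
u(s)` measurable for controls `u` that are merely measurable. -/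
theorem continuous_waveGroup_uncurry (hΛ : WaveHypothesis Λ) :
    Continuous fun r : ℝ × StateSpace Λ => waveGroup Λ r.1 r.2 := by
  rw [continuous_iff_continuousAt]
  rintro ⟨s, x⟩
  have h1 : Filter.Tendsto (fun r : ℝ × StateSpace Λ => waveGroup Λ r.1 (r.2 - x))
      (nhds (s, x)) (nhds 0) := by
    rw [tendsto_zero_iff_norm_tendsto_zero]
    simp only [norm_waveGroup hΛ]
    have : Continuous fun r : ℝ × StateSpace Λ => ‖r.2 - x‖ := by fun_prop
    simpa using this.tendsto (s, x)
  have h2 := ((continuous_waveGroup_apply hΛ x).comp continuous_fst).tendsto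
    ((s, x) : ℝ × StateSpace Λ)
  have h3 := h1.add h2
  simpa [ContinuousAt, ← map_add, Function.comp_def] using h3

theorem sqrt_eigenvalue_pos (hΛ : WaveHypothesis Λ) {μ : ℝ} (hμ : μ ∈ eigenvalueSet Λ) :
    0 < √μ := Real.sqrt_pos.mpr (hΛ.eigenvalue_pos hμ)

theorem bddOnEigs_intSinSq (hΛ : WaveHypothesis Λ) {t : ℝ} (ht : 0 < t) :
    BddOnEigs Λ fun μ => intSinSq t √μ := ⟨t, fun μ hμ => by
  obtain ⟨h1, h2⟩ := intSinSq_mem (sqrt_eigenvalue_pos hΛ hμ) ht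
  rwa [abs_of_nonneg h1]⟩

theorem bddOnEigs_intCosSq (hΛ : WaveHypothesis Λ) {t : ℝ} (ht : 0 < t) :
    BddOnEigs Λ fun μ => intCosSq t √μ := ⟨t, fun μ hμ => by
  obtain ⟨h1, h2⟩ := intCosSq_mem (sqrt_eigenvalue_pos hΛ hμ) ht
  rwa [abs_of_nonneg h1]⟩

theorem bddOnEigs_intSinCos (hΛ : WaveHypothesis Λ) {t : ℝ} (ht : 0 < t) :
    BddOnEigs Λ fun μ => intSinCos t √μ :=
  ⟨t, fun _ hμ => abs_intSinCos_le (sqrt_eigenvalue_pos hΛ hμ) ht⟩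

theorem exists_inv_gramDet_le (hΛ : WaveHypothesis Λ) {T : ℝ} :
    ∃ K, 0 < K ∧ ∀ t, 0 < t → t ≤ T → ∀ μ ∈ eigenvalueSet Λ, |(gramDet t √μ)⁻¹| ≤ K / t ^ 4 := by
  obtain ⟨m, hm, hle⟩ := hΛ.exists_lower_bound
  refine ⟨432 * (1 / m + T ^ 2), by positivity, fun t ht htT μ hμ => ?_⟩
  have hω := sqrt_eigenvalue_pos hΛ hμ
  have hD := gramDet_pos hω ht
  have h := pow_four_le_gramDet (m := m) (T := T) hm
    (by rw [Real.sq_sqrt (hΛ.eigenvalue_pos hμ).le]; exact hle μ hμ) hω ht htT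
  rw [abs_of_pos (by positivity), le_div_iff₀ (by positivity), inv_mul_le_iff₀ hD]
  linarith

theorem bddOnEigs_inv_gramDet (hΛ : WaveHypothesis Λ) {t : ℝ} (ht : 0 < t) :
    BddOnEigs Λ fun μ => (gramDet t √μ)⁻¹ := by
  obtain ⟨K, -, hK⟩ := exists_inv_gramDet_le hΛ (T := t)
  exact ⟨_, hK t ht le_rfl⟩

theorem gramian_integrand (hΛ : WaveHypothesis Λ) (s : ℝ) :
    waveGroup Λ s ∘L G Λ ∘L (G Λ).adjoint ∘L (waveGroup Λ s).adjoint =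
      blockOp Λ (fun μ => Real.sin (√μ * s) * Real.sin (√μ * s))
        (fun μ => Real.sin (√μ * s) * Real.cos (√μ * s))
        (fun μ => Real.sin (√μ * s) * Real.cos (√μ * s))
        (fun μ => Real.cos (√μ * s) * Real.cos (√μ * s)) := by
  have hc := bddOnEigs_cos (Λ := Λ) s
  have hs := bddOnEigs_sin (Λ := Λ) s
  have h0 := BddOnEigs.const (Λ := Λ) 0
  have h1 := BddOnEigs.const (Λ := Λ) 1
  rw [← ContinuousLinearMap.comp_assoc (G Λ), G_comp_adjoint hΛ, waveGroup_adjoint hΛ,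
    waveGroup_eq_blockOp hΛ, blockOp_comp hΛ h0 h0 h0 h1 hc hs.neg hs hc,
    blockOp_comp hΛ hc hs hs.neg hc ((h0.mul hc).add (h0.mul hs)) ((h0.mul hs.neg).add (h0.mul hc))
      ((h0.mul hc).add (h1.mul hs)) ((h0.mul hs.neg).add (h1.mul hc))]
  congr 1 <;> ext μ <;> ring

theorem intervalIntegrable_gramian_and_integral_eq (hΛ : WaveHypothesis Λ) {t : ℝ} (ht : 0 < t)
    (x : StateSpace Λ) : IntervalIntegrable (fun s => (waveGroup Λ s ∘L G Λ ∘L (G Λ).adjoint ∘L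
        (waveGroup Λ s).adjoint) x) volume 0 t ∧
      blockOp Λ (fun μ => intSinSq t √μ) (fun μ => intSinCos t √μ) (fun μ => intSinCos t √μ)
        (fun μ => intCosSq t √μ) x = ∫ s in (0 : ℝ)..t, (waveGroup Λ s ∘L G Λ ∘L (G Λ).adjoint ∘L
        (waveGroup Λ s).adjoint) x := by
  have key : ∀ x y : ℝ, |x| ≤ 1 → |y| ≤ 1 → |x * y| ≤ 1 := fun x y hx hy => by
    rw [abs_mul]; exact mul_le_one₀ hx (abs_nonneg _) hy
  have k1 : ∀ s μ : ℝ, |Real.sin (√μ * s) * Real.sin (√μ * s)| ≤ 1 := fun s μ =>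
    key _ _ (Real.abs_sin_le_one _) (Real.abs_sin_le_one _)
  have k2 : ∀ s μ : ℝ, |Real.sin (√μ * s) * Real.cos (√μ * s)| ≤ 1 := fun s μ =>
    key _ _ (Real.abs_sin_le_one _) (Real.abs_cos_le_one _)
  have k3 : ∀ s μ : ℝ, |Real.cos (√μ * s) * Real.cos (√μ * s)| ≤ 1 := fun s μ =>
    key _ _ (Real.abs_cos_le_one _) (Real.abs_cos_le_one _)
  simp only [gramian_integrand hΛ]
  refine ⟨(continuous_blockOp hΛ zero_le_one k1 k2 k2 k3 (fun _ => by fun_prop)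
    (fun _ => by fun_prop) (fun _ => by fun_prop) (fun _ => by fun_prop) x).intervalIntegrable _ _,
    ?_⟩
  rw [integral_blockOp hΛ zero_le_one k1 k2 k2 k3 (fun _ => by fun_prop)
    (fun _ => by fun_prop) (fun _ => by fun_prop) (fun _ => by fun_prop)]
  rw [blockOp_congr hΛ (bddOnEigs_intSinSq hΛ ht) (bddOnEigs_intSinCos hΛ ht)
    (bddOnEigs_intSinCos hΛ ht) (bddOnEigs_intCosSq hΛ ht)
    (fun μ hμ => (integral_sin_sq_mul (sqrt_eigenvalue_pos hΛ hμ)).symm)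
    (fun μ hμ => (integral_sin_mul_cos_mul (sqrt_eigenvalue_pos hΛ hμ)).symm)
    (fun μ hμ => (integral_sin_mul_cos_mul (sqrt_eigenvalue_pos hΛ hμ)).symm)
    (fun μ hμ => (integral_cos_sq_mul (sqrt_eigenvalue_pos hΛ hμ)).symm)]

end WaveGroup

/-! ### Inversion of `Q_t` and bounds on its inverse. -/

section Gramian

variable {U : Type*} [NormedAddCommGroup U] [InnerProductSpace ℝ U] [CompleteSpace U]
  {Λ : U →ₗ.[ℝ] U}

theorem Q_eq_blockOp (hΛ : WaveHypothesis Λ) {t : ℝ} (ht : 0 < t) :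
    Q Λ t = blockOp Λ (fun μ => intSinSq t √μ) (fun μ => intSinCos t √μ)
      (fun μ => intSinCos t √μ) (fun μ => intCosSq t √μ) :=
  strongIntegral_eq (intervalIntegrable_gramian_and_integral_eq hΛ ht)

theorem Q_apply (hΛ : WaveHypothesis Λ) {t : ℝ} (ht : 0 < t) (x : StateSpace Λ) :
    Q Λ t x = ∫ s in (0 : ℝ)..t,
      waveGroup Λ s (G Λ ((G Λ).adjoint ((waveGroup Λ s).adjoint x))) := by
  rw [Q_eq_blockOp hΛ ht]
  exact (intervalIntegrable_gramian_and_integral_eq hΛ ht x).2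

theorem exists_isPositive_sqrt_Q (hΛ : WaveHypothesis Λ) {t : ℝ} (ht : 0 < t) :
    ∃ S : StateSpace Λ →L[ℝ] StateSpace Λ, S.IsPositive ∧ S ∘L S = Q Λ t := by
  rw [Q_eq_blockOp hΛ ht]
  refine exists_isPositive_sqrt_blockOp hΛ (bddOnEigs_intSinSq hΛ ht) (bddOnEigs_intCosSq hΛ ht)
    (fun μ hμ => (intSinSq_mem (sqrt_eigenvalue_pos hΛ hμ) ht).1)
    (fun μ hμ => (intCosSq_mem (sqrt_eigenvalue_pos hΛ hμ) ht).1) fun μ hμ => ?_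
  have hω := sqrt_eigenvalue_pos hΛ hμ
  linarith [intSinSq_mul_intCosSq_sub (t := t) hω, gramDet_pos hω ht]

/-- The inverse of `Q_t`. -/
def QInv (Λ : U →ₗ.[ℝ] U) (t : ℝ) : StateSpace Λ →L[ℝ] StateSpace Λ :=
  blockOp Λ (fun μ => intCosSq t √μ * (gramDet t √μ)⁻¹)
    (fun μ => -(intSinCos t √μ * (gramDet t √μ)⁻¹))
    (fun μ => -(intSinCos t √μ * (gramDet t √μ)⁻¹))
    (fun μ => intSinSq t √μ * (gramDet t √μ)⁻¹)

/-- At each eigenvalue the symbol of `QInv` is the adjugate of that of `Q_t` divided by the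
determinant. -/
theorem Q_QInv (hΛ : WaveHypothesis Λ) {t : ℝ} (ht : 0 < t) (x : StateSpace Λ) :
    Q Λ t (QInv Λ t x) = x := by
  have hA := bddOnEigs_intSinSq hΛ ht
  have hB := bddOnEigs_intSinCos hΛ ht
  have hC := bddOnEigs_intCosSq hΛ ht
  have hD := bddOnEigs_inv_gramDet hΛ ht
  have h : Q Λ t ∘L QInv Λ t = ContinuousLinearMap.id ℝ (StateSpace Λ) := by
    rw [Q_eq_blockOp hΛ ht, QInv, blockOp_comp hΛ hA hB hB hC (hC.mul hD) (hB.mul hD).neg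
      (hB.mul hD).neg (hA.mul hD), ← blockOp_one hΛ]
    refine blockOp_congr hΛ ((hA.mul (hC.mul hD)).add (hB.mul (hB.mul hD).neg))
      ((hA.mul (hB.mul hD).neg).add (hB.mul (hA.mul hD)))
      ((hB.mul (hC.mul hD)).add (hC.mul (hB.mul hD).neg))
      ((hB.mul (hB.mul hD).neg).add (hC.mul (hA.mul hD)))
      (fun μ hμ => ?_) (fun μ hμ => ?_) (fun μ hμ => ?_) (fun μ hμ => ?_)
    · have hω := sqrt_eigenvalue_pos hΛ hμ
      linear_combination (gramDet t √μ)⁻¹ * intSinSq_mul_intCosSq_sub (t := t) hω +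
        mul_inv_cancel₀ (gramDet_pos hω ht).ne'
    · ring
    · ring
    · have hω := sqrt_eigenvalue_pos hΛ hμ
      linear_combination (gramDet t √μ)⁻¹ * intSinSq_mul_intCosSq_sub (t := t) hω +
        mul_inv_cancel₀ (gramDet_pos hω ht).ne'
  exact congrArg (fun T : StateSpace Λ →L[ℝ] StateSpace Λ => T x) h

theorem inner_QInv (hΛ : WaveHypothesis Λ) {t : ℝ} (ht : 0 < t) (x y : StateSpace Λ) :
    ⟪QInv Λ t x, y⟫_ℝ = ⟪x, QInv Λ t y⟫_ℝ := by
  have hA := bddOnEigs_intSinSq hΛ ht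
  have hB := bddOnEigs_intSinCos hΛ ht
  have hC := bddOnEigs_intCosSq hΛ ht
  have hD := bddOnEigs_inv_gramDet hΛ ht
  have h : (QInv Λ t).adjoint = QInv Λ t := by
    rw [QInv, blockOp_adjoint hΛ (hC.mul hD) (hB.mul hD).neg (hB.mul hD).neg (hA.mul hD)]
  conv_rhs => rw [← h, ContinuousLinearMap.adjoint_inner_right]

theorem inner_Q (hΛ : WaveHypothesis Λ) {t : ℝ} (ht : 0 < t) (x y : StateSpace Λ) :
    ⟪Q Λ t x, y⟫_ℝ = ⟪x, Q Λ t y⟫_ℝ := by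
  have hA := bddOnEigs_intSinSq hΛ ht
  have hB := bddOnEigs_intSinCos hΛ ht
  have hC := bddOnEigs_intCosSq hΛ ht
  have h : (Q Λ t).adjoint = Q Λ t := by
    rw [Q_eq_blockOp hΛ ht, blockOp_adjoint hΛ hA hB hB hC]
  conv_rhs => rw [← h, ContinuousLinearMap.adjoint_inner_right]

/-- Both operators are self-adjoint, so the right inverse is also a left inverse. -/
theorem QInv_Q (hΛ : WaveHypothesis Λ) {t : ℝ} (ht : 0 < t) (x : StateSpace Λ) :
    QInv Λ t (Q Λ t x) = x := by
  refine ext_inner_right ℝ fun y => ?_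
  rw [inner_QInv hΛ ht, inner_Q hΛ ht, Q_QInv hΛ ht]

theorem range_sqrt_Q_and_norm_sq (hΛ : WaveHypothesis Λ) {t : ℝ} (ht : 0 < t)
    (x : StateSpace Λ) :
    (∃ y, posSqrt (Q Λ t) y = x) ∧ ‖QInvSqrt Λ t x‖ ^ 2 = ⟪x, QInv Λ t x⟫_ℝ :=
  pseudoInv_posSqrt (exists_isPositive_sqrt_Q hΛ ht) (Q_QInv hΛ ht) (QInv_Q hΛ ht) x

/-- The entries of the adjugate are at most `t` and the inverse determinant is at most `K / t⁴`,
whence the power `t⁻³`. -/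
theorem exists_norm_QInv_le (hΛ : WaveHypothesis Λ) (T : ℝ) :
    ∃ K, 0 < K ∧ ∀ t, 0 < t → t ≤ T → ∀ x : StateSpace Λ,
      ‖QInv Λ t x‖ ≤ K / t ^ 3 * ‖x‖ := by
  obtain ⟨K, hK, h⟩ := exists_inv_gramDet_le hΛ (T := T)
  refine ⟨2 * K, by positivity, fun t ht htT x => ?_⟩
  have key : ∀ a : ℝ → ℝ, (∀ μ ∈ eigenvalueSet Λ, |a μ| ≤ t) →
      ∀ μ ∈ eigenvalueSet Λ, |a μ * (gramDet t √μ)⁻¹| ≤ K / t ^ 3 := fun a ha μ hμ => by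
    rw [abs_mul]
    calc |a μ| * |(gramDet t √μ)⁻¹| ≤ t * (K / t ^ 4) :=
          mul_le_mul (ha μ hμ) (h t ht htT μ hμ) (abs_nonneg _) ht.le
      _ = K / t ^ 3 := by field_simp
  have hA := key (fun μ => intSinSq t √μ) fun μ hμ => by
    obtain ⟨h1, h2⟩ := intSinSq_mem (sqrt_eigenvalue_pos hΛ hμ) ht
    rwa [abs_of_nonneg h1]
  have hC := key (fun μ => intCosSq t √μ) fun μ hμ => by
    obtain ⟨h1, h2⟩ := intCosSq_mem (sqrt_eigenvalue_pos hΛ hμ) ht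
    rwa [abs_of_nonneg h1]
  have hB : ∀ μ ∈ eigenvalueSet Λ, |-(intSinCos t √μ * (gramDet t √μ)⁻¹)| ≤ K / t ^ 3 :=
    fun μ hμ => by
      rw [abs_neg]
      exact key (fun μ => intSinCos t √μ)
        (fun μ hμ => abs_intSinCos_le (sqrt_eigenvalue_pos hΛ hμ) ht) μ hμ
  refine (norm_blockOp_apply_le hΛ (by positivity) hC hB hB hA x).trans_eq ?_
  ring

/-- A state `G a` has zero first coordinate, so the form sees only the lower right entry of the
inverse Gramian conjugated by the rotation. There the large entry `∫ cos² / D` is cancelled, leaving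
`∫ sin² / D`. -/
theorem inner_QInv_waveGroup_G_le (hΛ : WaveHypothesis Λ) {t : ℝ} (ht : 0 < t) (a : DualV Λ) :
    ⟪waveGroup Λ t (G Λ a), QInv Λ t (waveGroup Λ t (G Λ a))⟫_ℝ ≤ 16 / t * ‖a‖ ^ 2 := by
  have hA := bddOnEigs_intSinSq hΛ ht
  have hB := bddOnEigs_intSinCos hΛ ht
  have hC := bddOnEigs_intCosSq hΛ ht
  have hD := bddOnEigs_inv_gramDet hΛ ht
  have hc := bddOnEigs_cos (Λ := Λ) t
  have hs := bddOnEigs_sin (Λ := Λ) t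
  have hp : posCoord Λ (waveGroup Λ t (G Λ a)) =
      funCalc Λ (fun μ => Real.sin (√μ * t)) (invSqrtV Λ a) := by
    rw [waveGroup_eq_blockOp hΛ, posCoord_blockOp, posCoord_G, velCoord_G]; simp
  have hv : velCoord Λ (waveGroup Λ t (G Λ a)) =
      funCalc Λ (fun μ => Real.cos (√μ * t)) (invSqrtV Λ a) := by
    rw [waveGroup_eq_blockOp hΛ, velCoord_blockOp hΛ, posCoord_G, velCoord_G]; simp
  have hsC := hs.mul (hC.mul hD |>.mul hs)
  have hsB := hs.mul ((hB.mul hD).neg.mul hc)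
  have hcB := hc.mul ((hB.mul hD).neg.mul hs)
  have hcA := hc.mul (hA.mul hD |>.mul hc)
  have key : ⟪waveGroup Λ t (G Λ a), QInv Λ t (waveGroup Λ t (G Λ a))⟫_ℝ =
      ⟪invSqrtV Λ a, funCalc Λ (fun μ => intSinSq t √μ * (gramDet t √μ)⁻¹) (invSqrtV Λ a)⟫_ℝ := by
    rw [inner_eq_coords, QInv, posCoord_blockOp, velCoord_blockOp hΛ, hp, hv,
      ← funCalc_mul hΛ (hC.mul hD) hs, ← funCalc_mul hΛ (hB.mul hD).neg hc,
      ← funCalc_mul hΛ (hB.mul hD).neg hs, ← funCalc_mul hΛ (hA.mul hD) hc,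
      funCalc_inner hΛ hs, funCalc_inner hΛ hc, map_add, map_add,
      ← funCalc_mul hΛ hs (hC.mul hD |>.mul hs), ← funCalc_mul hΛ hs ((hB.mul hD).neg.mul hc),
      ← funCalc_mul hΛ hc ((hB.mul hD).neg.mul hs), ← funCalc_mul hΛ hc (hA.mul hD |>.mul hc),
      ← inner_add_right, ← funCalc_add hΛ hsC hsB, ← funCalc_add hΛ hcB hcA,
      ← funCalc_add hΛ (hsC.add hsB) (hcB.add hcA)]
    congr 2
    refine funCalc_congr hΛ ((hsC.add hsB).add (hcB.add hcA)) fun μ hμ => ?_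
    -- This is the scalar cancellation: the four terms coming from `sin` and `cos` collapse to `∫
    -- sin²`.
    conv_rhs => rw [← conj_inverse_gram (sqrt_eigenvalue_pos hΛ hμ)]
    ring
  rw [key]
  refine (real_inner_le_norm _ _).trans ?_
  have h1 := norm_funCalc_apply_le hΛ (f := fun μ => intSinSq t √μ * (gramDet t √μ)⁻¹)
    (C := 16 / t) (by positivity) (fun μ hμ => by
      have hω := sqrt_eigenvalue_pos hΛ hμ
      have h2 := (intSinSq_mem hω ht).1
      have h3 := gramDet_pos hω ht
      rw [abs_of_nonneg (by positivity), ← div_eq_mul_inv]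
      exact intSinSq_div_gramDet_le hω ht) (invSqrtV Λ a)
  rw [norm_invSqrtV] at h1 ⊢
  nlinarith [norm_nonneg a]

end Gramian

/-! ### Integrability of controls and of their pairings. -/

section Integrability

variable {E F : Type*} [NormedAddCommGroup E] [NormedAddCommGroup F]

theorem memLp_of_continuous {u : ℝ → E} (hu : Continuous u)
    (t : ℝ) : MemLp u 2 (volume.restrict (Set.Ioc 0 t)) := by
  obtain ⟨C, hC⟩ := (isCompact_Icc (a := (0 : ℝ)) (b := t)).exists_bound_of_continuousOn
    hu.continuousOn
  exact MemLp.of_bound hu.aestronglyMeasurable C <|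
    (ae_restrict_mem measurableSet_Ioc).mono fun s hs => hC s (Set.Ioc_subset_Icc_self hs)

theorem integrable_comp_of_norm_eq {μ : Measure ℝ} {Ψ : ℝ × E → F} (hΨ : Continuous Ψ)
    (hn : ∀ s x, ‖Ψ (s, x)‖ = ‖x‖) {u : ℝ → E} (hu : Integrable u μ) :
    Integrable (fun s => Ψ (s, u s)) μ := by
  have hm : AEStronglyMeasurable (fun s => (s, u s)) μ :=
    continuous_id.aestronglyMeasurable.prodMk hu.aestronglyMeasurable
  exact hu.mono (hΨ.comp_aestronglyMeasurable hm) (.of_forall fun s => (hn s (u s)).le)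

theorem MemLp.integrable_real_inner [InnerProductSpace ℝ E] {μ : Measure ℝ} {u v : ℝ → E}
    (hu : MemLp u 2 μ) (hv : MemLp v 2 μ) : Integrable (fun s => ⟪u s, v s⟫_ℝ) μ := by
  refine ((hu.integrable_norm_pow (by norm_num)).add
    (hv.integrable_norm_pow (by norm_num))).mono'
    (hu.aestronglyMeasurable.inner hv.aestronglyMeasurable) (.of_forall fun s => ?_)
  refine (norm_inner_le_norm _ _).trans ?_
  simp only [Pi.add_apply]
  nlinarith [sq_nonneg (‖u s‖ - ‖v s‖), sq_nonneg (‖u s‖ + ‖v s‖)]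

end Integrability

/-! ### The minimal energy control. -/

section Energy

variable {U : Type*} [NormedAddCommGroup U] [InnerProductSpace ℝ U] [CompleteSpace U]
  {Λ : U →ₗ.[ℝ] U}

/-- The control `s ↦ G^* e^{(t-s)A^*} z` adjoint to the final state `z`. -/
def adjointControl (Λ : U →ₗ.[ℝ] U) (t : ℝ) (z : StateSpace Λ) (s : ℝ) : DualV Λ :=
  (G Λ).adjoint ((waveGroup Λ (t - s)).adjoint z)

theorem continuous_adjointControl (hΛ : WaveHypothesis Λ) (t : ℝ) (z : StateSpace Λ) :
    Continuous (adjointControl Λ t z) :=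
  (G Λ).adjoint.continuous.comp
    ((continuous_waveGroup_adjoint_apply hΛ z).comp (continuous_const.sub continuous_id))

theorem continuous_waveGroup_G_uncurry (hΛ : WaveHypothesis Λ) (t : ℝ) :
    Continuous fun r : ℝ × DualV Λ => waveGroup Λ (t - r.1) (G Λ r.2) := by
  have h1 : Continuous fun r : ℝ × DualV Λ => (t - r.1, G Λ r.2) :=
    (continuous_const.sub continuous_fst).prodMk ((G Λ).continuous.comp continuous_snd)
  have h2 := (continuous_waveGroup_uncurry hΛ).comp h1
  simp only [Function.comp_def] at h2
  exact h2

theorem intervalIntegrable_waveGroup_G (hΛ : WaveHypothesis Λ) {t : ℝ} (ht : 0 < t)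
    {u : ℝ → DualV Λ} (hu : MemLp u 2 (volume.restrict (Set.Ioc 0 t))) :
    IntervalIntegrable (fun s => waveGroup Λ (t - s) (G Λ (u s))) volume 0 t := by
  have hu1 : Integrable u (volume.restrict (Set.Ioc 0 t)) := hu.integrable one_le_two
  have hn : ∀ (s : ℝ) (x : DualV Λ), ‖waveGroup Λ (t - s) (G Λ x)‖ = ‖x‖ := fun s x => by
    rw [norm_waveGroup hΛ, norm_G]
  have h := integrable_comp_of_norm_eq (continuous_waveGroup_G_uncurry hΛ t) hn hu1
  exact (intervalIntegrable_iff_integrableOn_Ioc_of_le ht.le).mpr h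

theorem inner_integral_waveGroup_G (hΛ : WaveHypothesis Λ) {t : ℝ} (ht : 0 < t)
    {u : ℝ → DualV Λ} (hu : MemLp u 2 (volume.restrict (Set.Ioc 0 t))) (z : StateSpace Λ) :
    ⟪z, ∫ s in (0 : ℝ)..t, waveGroup Λ (t - s) (G Λ (u s))⟫_ℝ =
      ∫ s in (0 : ℝ)..t, ⟪adjointControl Λ t z s, u s⟫_ℝ := by
  have := (innerSL ℝ z).intervalIntegral_comp_comm (intervalIntegrable_waveGroup_G hΛ ht hu)
  simp only [innerSL_apply_apply] at this
  rw [← this]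
  simp only [adjointControl, ContinuousLinearMap.adjoint_inner_left]

/-- The substitution `s ↦ t - s` turns the integral into the one defining `Q_t`. -/
theorem integral_waveGroup_G_adjointControl (hΛ : WaveHypothesis Λ) {t : ℝ} (ht : 0 < t)
    (z : StateSpace Λ) :
    ∫ s in (0 : ℝ)..t, waveGroup Λ (t - s) (G Λ (adjointControl Λ t z s)) = Q Λ t z := by
  rw [Q_apply hΛ ht]
  have := intervalIntegral.integral_comp_sub_left (a := 0) (b := t)
    (fun s => waveGroup Λ s (G Λ ((G Λ).adjoint ((waveGroup Λ s).adjoint z)))) t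
  rw [sub_self, sub_zero] at this
  exact this

theorem integral_norm_sq_adjointControl (hΛ : WaveHypothesis Λ) {t : ℝ} (ht : 0 < t)
    (z : StateSpace Λ) :
    ∫ s in (0 : ℝ)..t, ‖adjointControl Λ t z s‖ ^ 2 = ⟪z, Q Λ t z⟫_ℝ := by
  rw [← integral_waveGroup_G_adjointControl hΛ ht, inner_integral_waveGroup_G hΛ ht
    (memLp_of_continuous (continuous_adjointControl hΛ t z) t)]
  simp only [real_inner_self_eq_norm_sq]

/-- The control of minimal energy. -/
theorem steers_adjointControl (hΛ : WaveHypothesis Λ) {t : ℝ} (ht : 0 < t) (h : StateSpace Λ) :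
    Steers Λ t h fun s => -adjointControl Λ t (QInv Λ t (waveGroup Λ t h)) s := by
  refine ⟨memLp_of_continuous (continuous_adjointControl hΛ t _).neg t, ?_⟩
  rw [mildSolution]
  simp only [map_neg, intervalIntegral.integral_neg]
  rw [integral_waveGroup_G_adjointControl hΛ ht, Q_QInv hΛ ht, add_neg_cancel]

/-- Let `-w` be the candidate optimal control. Every steering `u` has the same pairing with `w`,
namely `-⟪x, Q_t⁻¹ x⟫`, while `∫ |w|² = ⟪x, Q_t⁻¹ x⟫`. Expanding `∫ |u + w|² ≥ 0` gives the bound.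
-/
theorem Steers.inner_QInv_le (hΛ : WaveHypothesis Λ) {t : ℝ} (ht : 0 < t) {h : StateSpace Λ}
    {u : ℝ → DualV Λ} (hu : Steers Λ t h u) :
    ⟪waveGroup Λ t h, QInv Λ t (waveGroup Λ t h)⟫_ℝ ≤ ∫ s in (0 : ℝ)..t, ‖u s‖ ^ 2 := by
  obtain ⟨hL, hu⟩ := hu
  set x := waveGroup Λ t h with hx
  set w := adjointControl Λ t (QInv Λ t x) with hw
  have hwL : MemLp w 2 (volume.restrict (Set.Ioc 0 t)) :=
    memLp_of_continuous (continuous_adjointControl hΛ t _) t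
  have hint : ∀ f : ℝ → ℝ, Integrable f (volume.restrict (Set.Ioc 0 t)) →
      IntervalIntegrable f volume 0 t := fun f hf =>
    (intervalIntegrable_iff_integrableOn_Ioc_of_le ht.le).mpr hf
  have hi1 := hint _ (hL.integrable_norm_pow (by norm_num))
  have hi2 := hint _ (hwL.integrable_norm_pow (by norm_num))
  have hi3 := hint _ (MemLp.integrable_real_inner hwL hL)
  -- Reaching `0` at time `t` means that the control integral equals `-x`; it is paired here with
  -- `Q_t⁻¹ x`.
  have h1 : ∫ s in (0 : ℝ)..t, ⟪w s, u s⟫_ℝ = -⟪x, QInv Λ t x⟫_ℝ := by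
    rw [hw, ← inner_integral_waveGroup_G hΛ ht hL, eq_neg_of_add_eq_zero_right hu, inner_neg_right,
      real_inner_comm]
  have h2 : ∫ s in (0 : ℝ)..t, ‖w s‖ ^ 2 = ⟪x, QInv Λ t x⟫_ℝ := by
    rw [hw, integral_norm_sq_adjointControl hΛ ht, Q_QInv hΛ ht, real_inner_comm]
  have h3 : 0 ≤ ∫ s in (0 : ℝ)..t, (‖u s‖ ^ 2 + 2 * ⟪w s, u s⟫_ℝ + ‖w s‖ ^ 2) :=
    intervalIntegral.integral_nonneg ht.le fun s _ => by
      have := norm_add_sq_real (u s) (w s)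
      rw [real_inner_comm] at this
      rw [← this]; positivity
  rw [intervalIntegral.integral_add (hi1.add (hi3.const_mul 2)) hi2,
    intervalIntegral.integral_add hi1 (hi3.const_mul 2), intervalIntegral.integral_const_mul, h1,
    h2] at h3
  linarith

theorem isLeast_controlEnergies (hΛ : WaveHypothesis Λ) {t : ℝ} (ht : 0 < t) (h : StateSpace Λ) :
    IsLeast (controlEnergies Λ t h) ‖QInvSqrt Λ t (waveGroup Λ t h)‖ := by
  have hn := (range_sqrt_Q_and_norm_sq hΛ ht (waveGroup Λ t h)).2
  rw [← Real.sqrt_sq (norm_nonneg (QInvSqrt Λ t (waveGroup Λ t h))), hn]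
  constructor
  · refine ⟨_, steers_adjointControl hΛ ht h, ?_⟩
    simp only [norm_neg]
    rw [integral_norm_sq_adjointControl hΛ ht, Q_QInv hΛ ht, real_inner_comm]
  · rintro _ ⟨u, hu, rfl⟩
    exact Real.sqrt_le_sqrt (hu.inner_QInv_le hΛ ht)

end Energy

end WaveControl

end

/-! ### The three claims. -/

open WaveControl
theorem corollaryA2 {U : Type*} [NormedAddCommGroup U] [InnerProductSpace ℝ U] [CompleteSpace U]
    [TopologicalSpace.SeparableSpace U] (Λ : U →ₗ.[ℝ] U) (hΛ : WaveHypothesis Λ) :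
    (∀ t : ℝ, 0 < t → ∀ h : StateSpace Λ,
      (∃ y : StateSpace Λ, posSqrt (Q Λ t) y = waveGroup Λ t h) ∧
      (controlEnergies Λ t h).Nonempty ∧
      minimalEnergy Λ t h = ‖QInvSqrt Λ t (waveGroup Λ t h)‖) ∧
    (∀ T : ℝ, 0 < T → ∃ cT : ℝ, 0 < cT ∧ ∀ t : ℝ, 0 < t → t < T → ∀ h : StateSpace Λ,
      ‖QInvSqrt Λ t (waveGroup Λ t h)‖ ≤ cT / t ^ (3 / 2 : ℝ) * ‖h‖) ∧
    (∃ c : ℝ, 0 < c ∧ ∀ t : ℝ, 0 < t →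
      (∀ a : DualV Λ,
        ‖QInvSqrt Λ t (waveGroup Λ t (G Λ a))‖ ≤ c / t ^ (1 / 2 : ℝ) * ‖G Λ a‖ ∧
        ‖G Λ a‖ = ‖a‖) ∧
      (∀ a : U,
        ‖QInvSqrt Λ t (waveGroup Λ t (G Λ (incl Λ a)))‖
          ≤ c / t ^ (1 / 2 : ℝ) * ‖G Λ (incl Λ a)‖ ∧
        ‖G Λ (incl Λ a)‖ = ‖invSqrt Λ a‖)) := by
  refine ⟨fun t ht h => ?_, fun T _ => ?_, ?_⟩
  · have hl := isLeast_controlEnergies hΛ ht h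
    exact ⟨(range_sqrt_Q_and_norm_sq hΛ ht _).1, ⟨_, hl.1⟩, hl.csInf_eq⟩
  · obtain ⟨K, hK, hle⟩ := exists_norm_QInv_le hΛ T
    -- The form is at most `K t⁻³ |h|²`, the group being isometric, so the root `√K` serves for the
    -- norm.
    refine ⟨√K, Real.sqrt_pos.mpr hK, fun t ht htT h => ?_⟩
    refine (sq_le_sq₀ (norm_nonneg _) (by positivity)).mp ?_
    have hpow : (t ^ (3 / 2 : ℝ)) ^ 2 = t ^ 3 := by
      rw [← Real.rpow_natCast, ← Real.rpow_mul ht.le, ← Real.rpow_natCast t 3]; norm_num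
    rw [(range_sqrt_Q_and_norm_sq hΛ ht _).2, mul_pow, div_pow, Real.sq_sqrt hK.le, hpow]
    refine (real_inner_le_norm _ _).trans ?_
    have h1 := hle t ht htT.le (waveGroup Λ t h)
    rw [norm_waveGroup hΛ] at h1 ⊢
    nlinarith [mul_le_mul_of_nonneg_left h1 (norm_nonneg h)]
  -- The constant `4` is the square root of the `16` in `inner_QInv_waveGroup_G_le`.
  · have key : ∀ t : ℝ, 0 < t → ∀ a : DualV Λ,
        ‖QInvSqrt Λ t (waveGroup Λ t (G Λ a))‖ ≤ 4 / t ^ (1 / 2 : ℝ) * ‖G Λ a‖ := by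
      intro t ht a
      refine (sq_le_sq₀ (norm_nonneg _) (by positivity)).mp ?_
      have hpow : (t ^ (1 / 2 : ℝ)) ^ 2 = t := by
        rw [← Real.sqrt_eq_rpow, Real.sq_sqrt ht.le]
      rw [(range_sqrt_Q_and_norm_sq hΛ ht _).2, mul_pow, div_pow, hpow, norm_G]
      refine (inner_QInv_waveGroup_G_le hΛ ht a).trans_eq ?_
      norm_num
    exact ⟨4, by norm_num, fun t ht => ⟨fun a => ⟨key t ht a, norm_G a⟩,
      fun a => ⟨key t ht _, by rw [norm_G, norm_incl]⟩⟩⟩
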